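/- For $n\ge 1$ let $f:\mathbb{Z}_n\times\mathbb{Z}_n\to\mathbb{Z}_n$ be a rule chosen uniformly at random from all $n^{n^2}$ such maps. Started from a configuration $\xi_0\in\mathbb{Z}_n^{\mathbb{Z}}$, the cellular automaton with rule $f$ evolves by $\xi_{t+1}(x)=f(\xi_t(x-1),\xi_t(x))$. A configuration $\xi_0$ is a periodic solution (PS) with temporal period $\tau$ and spatial period $\sigma$ if $\sigma\ge 1$ is the least positive integer with $\xi_0(x+\sigma)=\xi_0(x)$ for all $x\in\mathbb{Z}$, and $\tau\ge 1$ is the least positive integer with $\xi_\tau=\xi_0$. An initial configuration $\eta_0$ is proper for $\xi_0$ if there is $y\in\mathbb{Z}$ with $\eta_0(x)=\xi_0(x)$ for all $x\le y$. Put $$s_t(\eta_0)=\sup\{x\in\mathbb{Z}:\ \eta_t(z)=\xi_t(z)\text{ for all } z\le x\}\in[-\infty,\infty],\qquad v(\eta_0)=\liminf_{t\to\infty}\frac{s_t(\eta_0)}{t}.$$ A PS $\xi_0$ is a weakly robust periodic solution (WRPS) if $\inf\{v(\eta_0):\eta_0\text{ proper for }\xi_0\}>0$. The tile of $\xi_0$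 is the array $T=(a_{i,j})$, $a_{i,j}=\xi_i(j)$, $0\le i<\tau$, $0\le j<\sigma$. Its lag is $\ell(T)=p(T)-s(T)\ge 0$, where $p(T)$ is the number of distinct pairs $(a_{i,j},a_{i,j+1})$ (second subscript modulo $\sigma$) and $s(T)$ is the number of distinct states $a_{i,j}$; the tile is simple if $\ell(T)=0$. Let $\mathcal{R}_{\tau,\sigma,n}$ be the random set of WRPS of $f$ with periods exactly $(\tau,\sigma)$, and let $\mathcal{R}^{(\ell)}_{\tau,\sigma,n}$ be the set of those whose tile has lag $\ell$. Proposition. Let $\tau,\sigma\ge 1$ be fixed integers. 1. If $\sigma\mid\tau$, then, as $n\to\infty$, $$\mathbb{P}\left(\mathcal{R}_{\tau,\sigma,n}\neq\emptyset\right)=\frac{c(\tau,\sigma)}{n}+o\left(\frac1n\right),\qquad c(\tau,\sigma)=\varphi(\sigma),$$ where $\varphi$ is Euler's totient function. 2. For every fixed $\ell>0$ (with no divisibility assumption), $\mathbb{P}\left(\mathcal{R}^{(\ell)}_{\tau,\sigma,n}\neq\emptyset\right)=o(1/n)$ as $n\to\infty$. -/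

import Mathlib

open Filter Asymptotics Topology

/-- A `2`-neighbour cellular automaton rule with `n` states. -/
abbrev CARule (n : ℕ) : Type := Fin n → Fin n → Fin n

/-- A (global) configuration with `n` states. -/
abbrev CAConfig (n : ℕ) : Type := ℤ → Fin n

/-- One time step of the cellular automaton with rule `f`: the new state at `x` is computed from
the old states at `x - 1` and `x`. -/
def caStep {n : ℕ} (f : CARule n) (ξ : CAConfig n) : CAConfig n :=
  fun x => f (ξ (x - 1)) (ξ x)

/-- The configuration at time `t` when the rule `f` is started from `ξ`. -/
def caEvolve {n : ℕ} (f : CARule n) (ξ : CAConfig n) (t : ℕ) : CAConfig n :=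
  (caStep f)^[t] ξ

/-- `ξ` is a periodic solution (PS) configuration of `f` with temporal period `τ` and spatial
period `σ`, both periods being minimal. -/
structure IsPS {n : ℕ} (f : CARule n) (τ σ : ℕ) (ξ : CAConfig n) : Prop where
  spatial : IsLeast {s : ℕ | 0 < s ∧ ∀ x : ℤ, ξ (x + s) = ξ x} σ
  temporal : IsLeast {t : ℕ | 0 < t ∧ caEvolve f ξ t = ξ} τ

/-- `η` is a proper initial configuration for `ξ`: it agrees with `ξ` on a left half-line. -/
def IsProper {n : ℕ} (ξ η : CAConfig n) : Prop :=
  ∃ y : ℤ, ∀ x ≤ y, η x = ξ x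

/-- The front at time `t`: the rightmost location up to which the evolution of `η` agrees with
the evolution of `ξ` (it is `⊤` if they agree everywhere). -/
noncomputable def caFront {n : ℕ} (f : CARule n) (ξ η : CAConfig n) (t : ℕ) : EReal :=
  sSup {s : EReal | ∃ x : ℤ, s = ((x : ℝ) : EReal) ∧
    ∀ z ≤ x, caEvolve f η t z = caEvolve f ξ t z}

/-- The expansion velocity of `ξ` in the initial environment `η`. -/
noncomputable def velocityIn {n : ℕ} (f : CARule n) (ξ η : CAConfig n) : EReal :=
  liminf (fun t : ℕ => caFront f ξ η t / ((t : ℝ) : EReal)) atTop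

/-- The expansion velocity of `ξ`: the infimum over all proper initial environments. -/
noncomputable def expansionVelocity {n : ℕ} (f : CARule n) (ξ : CAConfig n) : EReal :=
  sInf {v : EReal | ∃ η : CAConfig n, IsProper ξ η ∧ v = velocityIn f ξ η}

/-- `ξ` is a weakly robust periodic solution (WRPS) of `f` with periods `τ` and `σ`. -/
structure IsWRPS {n : ℕ} (f : CARule n) (τ σ : ℕ) (ξ : CAConfig n) : Prop where
  isPS : IsPS f τ σ ξ
  weaklyRobust : 0 < expansionVelocity f ξ

/-- The tile of `ξ`: the rectangle with rows (times) `0, …, τ - 1` and columns (sites)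
`0, …, σ - 1` of the space-time configuration. -/
def caTile {n : ℕ} (f : CARule n) (τ σ : ℕ) (ξ : CAConfig n) : Fin τ → Fin σ → Fin n :=
  fun i j => caEvolve f ξ i (j : ℕ)

/-- The number `s(T)` of different states in the tile `T`. -/
noncomputable def stateNumber {n τ σ : ℕ} (T : Fin τ → Fin σ → Fin n) : ℕ :=
  {a : Fin n | ∃ i j, a = T i j}.ncard

/-- The assignment number `p(T)`: the number of different horizontally adjacent pairs
`(a_{i,j}, a_{i,j+1})` in `T`, the second subscript being taken modulo `σ` (`finRotate σ` is the
cyclic successor on `Fin σ`). -/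
noncomputable def assignmentNumber {n τ σ : ℕ} (T : Fin τ → Fin σ → Fin n) : ℕ :=
  {q : Fin n × Fin n | ∃ i j, q = (T i j, T i (finRotate σ j))}.ncard

/-- The subtraction in the definition of the lag is never truncated. -/
theorem stateNumber_le_assignmentNumber {n τ σ : ℕ} (T : Fin τ → Fin σ → Fin n) :
    stateNumber T ≤ assignmentNumber T := by
  have h : {a : Fin n | ∃ i j, a = T i j} =
      Prod.fst '' {q : Fin n × Fin n | ∃ i j, q = (T i j, T i (finRotate σ j))} := by
    ext a
    constructor
    · rintro ⟨i, j, rfl⟩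
      exact ⟨_, ⟨i, j, rfl⟩, rfl⟩
    · rintro ⟨_, ⟨i, j, rfl⟩, rfl⟩
      exact ⟨i, j, rfl⟩
  unfold stateNumber assignmentNumber
  rw [h]
  exact Set.ncard_image_le (Set.toFinite _)

/-- The lag `ℓ(T) = p(T) - s(T)` of a tile. -/
noncomputable def lag {n τ σ : ℕ} (T : Fin τ → Fin σ → Fin n) : ℕ :=
  assignmentNumber T - stateNumber T

/-- The set of WRPS configurations of `f` with periods `τ` and `σ`. -/
def wrpsSet {n : ℕ} (f : CARule n) (τ σ : ℕ) : Set (CAConfig n) :=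
  {ξ | IsWRPS f τ σ ξ}

/-- The set of WRPS configurations of `f` with periods `τ` and `σ` whose tile has lag `ℓ`. -/
def wrpsSetLag {n : ℕ} (f : CARule n) (τ σ ℓ : ℕ) : Set (CAConfig n) :=
  {ξ | IsWRPS f τ σ ξ ∧ lag (caTile f τ σ ξ) = ℓ}

/-- The probability of the event `E` for a rule chosen uniformly among all `n ^ (n ^ 2)` rules
with `n` states. -/
noncomputable def ruleProb (n : ℕ) (E : Set (CARule n)) : ℝ :=
  (E.ncard : ℝ) / (n : ℝ) ^ (n ^ 2)

/-! Write a periodic solution as a doubly periodic array `U`. Sites look only to the left, so each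
column, once correct, drives the next. Weak robustness is equivalent to `Collapses` for every pair
of neighbouring columns: from any initial state and phase, the driven dynamics reaches the correct
column (`IsWRPS.collapses`, `IsPS.isWRPS`).

An array with `s` states and `p` adjacent pairs prescribes `p` values of the rule, which costs `n ^
(-p)`, while the sum of `n ^ (-s)` over all arrays stays bounded (`sum_inv_pow_card_range_le`).
Hence everything depends on the extra factor gained beyond `n ^ (-s)`.

If `p > s`, one factor `1/n` comes from the pins, and given boundedly many pins collapse has
conditional probability tending to `0` (`exists_absorbed_bound`). That bound is a switching
argument: redirecting one value of the rule closes an unabsorbed cycle of any of `L` lengths, and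
the divergence of the harmonic series makes absorption unlikely. So positive lag contributes
`o(1/n)`.

If `p = s`, equality of entries is invariant under translations. When drivers are distinct states,
the collapse probability is computed exactly: a selection dies precisely when the determinant of `1
- A` is `1` and not `0`; multilinearity averages it, and `det (1 - XY) = det (1 - YX)` reduces it to
the drivers alone, each stopping with probability `1/n`. Two disjoint driver orbits cost `n ^ (-2)`
and are negligible. A single orbit means `U t x = a (t + x m)` with `a` an injective cyclic word of
length `τ` and `m` of order `σ` in `ZMod τ`, and it collapses with probability `1 - (1 - 1/n) ^ τ`,
asymptotically `τ/n`.

There are `φ(σ)` choices of `m` and about `n ^ τ` words, so the expected number of good words is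
asymptotic to `φ(σ) τ / n`. The `τ` shifts of a word come together, and pairs of good words that are
not shifts of each other contribute `o(1/n)`. Dividing by `τ` gives `φ(σ)/n`. -/

/-! ### Probabilities of events for a uniform rule -/

open Classical in
theorem ruleProb_eq_sum (n : ℕ) (E : Set (CARule n)) :
    ruleProb n E = (∑ f : CARule n, if f ∈ E then (1 : ℝ) else 0) / (n : ℝ) ^ (n ^ 2) := by
  unfold ruleProb
  rw [Finset.sum_boole, Set.ncard_eq_toFinset_card']
  congr 3
  ext f
  simp

theorem ruleProb_nonneg (n : ℕ) (E : Set (CARule n)) : 0 ≤ ruleProb n E := by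
  unfold ruleProb; positivity

theorem ruleProb_mono {n : ℕ} {E F : Set (CARule n)} (h : E ⊆ F) :
    ruleProb n E ≤ ruleProb n F := by
  unfold ruleProb
  have := Set.ncard_le_ncard h (Set.toFinite F)
  gcongr

theorem ruleProb_empty (n : ℕ) : ruleProb n ∅ = 0 := by
  simp [ruleProb]

open Classical in
/-- A pointwise inequality between weighted counts of events yields the inequality between the
weighted sums of their probabilities. -/
theorem ruleProb_sum_le_sum {n : ℕ} {ι κ : Type*} [Fintype ι] [Fintype κ]
    (A : ι → Set (CARule n)) (B : κ → Set (CARule n)) (a b : ℝ)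
    (h : ∀ f, a * (∑ i, if f ∈ A i then (1 : ℝ) else 0) ≤
      b * ∑ j, if f ∈ B j then (1 : ℝ) else 0) :
    a * ∑ i, ruleProb n (A i) ≤ b * ∑ j, ruleProb n (B j) := by
  simp_rw [ruleProb_eq_sum, ← Finset.sum_div]
  rw [Finset.sum_comm, Finset.sum_comm (s := (Finset.univ : Finset κ)), ← mul_div_assoc,
    ← mul_div_assoc, Finset.mul_sum, Finset.mul_sum]
  exact div_le_div_of_nonneg_right (Finset.sum_le_sum fun f _ => h f) (by positivity)

theorem ruleProb_exists_le {n : ℕ} {ι : Type*} [Fintype ι] (A : ι → Set (CARule n))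
    (E : Set (CARule n)) (h : ∀ f ∈ E, ∃ i, f ∈ A i) :
    ruleProb n E ≤ ∑ i, ruleProb n (A i) := by
  classical
  have := ruleProb_sum_le_sum (fun _ : Unit => E) A 1 1 (fun f => by
    simp only [Finset.univ_unique, Finset.sum_const, Finset.card_singleton, one_smul, one_mul]
    by_cases hf : f ∈ E
    · obtain ⟨i, hi⟩ := h f hf
      rw [if_pos hf]
      calc (1 : ℝ) = if f ∈ A i then (1 : ℝ) else 0 := by rw [if_pos hi]
        _ ≤ _ := Finset.single_le_sum (f := fun j => if f ∈ A j then (1 : ℝ) else 0)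
          (fun j _ => by positivity) (Finset.mem_univ i)
    · rw [if_neg hf]
      exact Finset.sum_nonneg fun j _ => by positivity)
  simpa using this

theorem ruleProb_union_le {n : ℕ} (E F : Set (CARule n)) :
    ruleProb n (E ∪ F) ≤ ruleProb n E + ruleProb n F := by
  have := ruleProb_exists_le (fun b : Bool => if b then E else F) (E ∪ F) (by
    rintro f (hf | hf)
    · exact ⟨true, hf⟩
    · exact ⟨false, hf⟩)
  simpa using this

/-- The values of a uniform rule at different pairs are independent and uniform; this product
structure is the only source of exact probabilities below. -/
theorem ncard_pinned (n : ℕ) (E : Finset (Fin n × Fin n)) (h : Fin n × Fin n → Fin n) :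
    {f : CARule n | ∀ e ∈ E, f e.1 e.2 = h e}.ncard * n ^ E.card = n ^ (n ^ 2) := by
  classical
  have h1 : {f : CARule n | ∀ e ∈ E, f e.1 e.2 = h e}.ncard =
      (Fintype.piFinset fun e => if e ∈ E then {h e} else Finset.univ).card := by
    rw [← Set.ncard_coe_finset]
    refine Set.ncard_congr (fun f _ e => f e.1 e.2) ?_ ?_ ?_
    · intro f hf
      simp only [Finset.mem_coe, Fintype.mem_piFinset]
      intro e
      by_cases he : e ∈ E
      · simpa [he] using hf e he
      · simp [he]
    · intro f g _ _ hfg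
      funext x y
      exact congrFun hfg (x, y)
    · intro g hg
      refine ⟨fun x y => g (x, y), ?_, rfl⟩
      intro e he
      have := Fintype.mem_piFinset.1 (Finset.mem_coe.1 hg) e
      simpa [he] using this
  rw [h1, Fintype.card_piFinset]
  have h2 : ∀ e : Fin n × Fin n, (if e ∈ E then {h e} else (Finset.univ : Finset (Fin n))).card =
      if e ∈ E then 1 else n := by
    intro e; split_ifs <;> simp
  simp_rw [h2]
  have h3 : n ^ E.card = ∏ e : Fin n × Fin n, if e ∈ E then n else 1 := by
    simp
  rw [h3, ← Finset.prod_mul_distrib]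
  have h4 : ∀ e : Fin n × Fin n, ((if e ∈ E then 1 else n) * if e ∈ E then n else 1) = n := by
    intro e; split_ifs <;> simp
  simp_rw [h4]
  simp [sq]

theorem ruleProb_pinned {n : ℕ} (hn : 0 < n) (E : Finset (Fin n × Fin n))
    (h : Fin n × Fin n → Fin n) :
    ruleProb n {f : CARule n | ∀ e ∈ E, f e.1 e.2 = h e} = ((n : ℝ)⁻¹) ^ E.card := by
  have h1 := ncard_pinned n E h
  have h2 : (n : ℝ) ≠ 0 := by positivity
  unfold ruleProb
  rw [div_eq_iff (by positivity), ← Nat.cast_pow, ← h1]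
  push_cast
  rw [mul_comm, mul_assoc, ← mul_pow, mul_inv_cancel₀ h2, one_pow, mul_one]

/-! ### Sums over maps weighted by the size of the range -/

/-- Adding a value to a map on `k` points either repeats one of at most `k` old values at no cost,
or picks one of at most `n` new values at cost `1/n`. The sum therefore grows by a factor at most `k
+ 1`. -/
theorem sum_inv_pow_card_range_le_factorial (k n : ℕ) :
    ∑ c : Fin k → Fin n, ((n : ℝ)⁻¹) ^ (Set.range c).ncard ≤ (k.factorial : ℝ) := by
  classical
  induction k with
  | zero => simp [Set.range_eq_empty]
  | succ k ih =>
    have key : ∀ c : Fin k → Fin n, ∑ x : Fin n, ((n : ℝ)⁻¹) ^ (insert x (Set.range c)).ncard ≤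
        ((n : ℝ)⁻¹) ^ (Set.range c).ncard * (k + 1) := by
      intro c
      have h1 : ∀ x : Fin n, ((n : ℝ)⁻¹) ^ (insert x (Set.range c)).ncard ≤
          ((n : ℝ)⁻¹) ^ (Set.range c).ncard *
            ((if x ∈ Finset.univ.image c then 1 else 0) + (n : ℝ)⁻¹) := by
        intro x
        by_cases hx : x ∈ Set.range c
        · rw [Set.insert_eq_of_mem hx, if_pos (by simpa using hx)]
          refine le_mul_of_one_le_right (by positivity) ?_
          have : 0 ≤ (n : ℝ)⁻¹ := by positivity
          linarith
        · rw [Set.ncard_insert_of_notMem hx (Set.toFinite _), if_neg (by simpa using hx), pow_succ,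
            zero_add]
      refine (Finset.sum_le_sum fun x _ => h1 x).trans ?_
      rw [← Finset.mul_sum]
      gcongr
      rw [Finset.sum_add_distrib, Finset.sum_boole]
      refine add_le_add ?_ ?_
      · have : (Finset.univ.filter fun x => x ∈ Finset.univ.image c) = Finset.univ.image c := by
          ext x; simp
        rw [this]
        have h2 := Finset.card_image_le (s := Finset.univ) (f := c)
        rw [Finset.card_univ, Fintype.card_fin] at h2
        exact_mod_cast h2
      · simp only [Finset.sum_const, Finset.card_univ, Fintype.card_fin, nsmul_eq_mul]
        exact mul_inv_le_one
    calc ∑ c : Fin (k + 1) → Fin n, ((n : ℝ)⁻¹) ^ (Set.range c).ncard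
        = ∑ p : Fin n × (Fin k → Fin n), ((n : ℝ)⁻¹) ^ (insert p.1 (Set.range p.2)).ncard := by
          refine (Fintype.sum_equiv (Fin.consEquiv fun _ => Fin n) _ _ fun p => ?_).symm
          congr 2
          exact (Fin.range_cons p.1 p.2).symm
      _ = ∑ c : Fin k → Fin n, ∑ x : Fin n, ((n : ℝ)⁻¹) ^ (insert x (Set.range c)).ncard := by
          rw [Fintype.sum_prod_type, Finset.sum_comm]
      _ ≤ ∑ c : Fin k → Fin n, ((n : ℝ)⁻¹) ^ (Set.range c).ncard * (k + 1) :=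
          Finset.sum_le_sum fun c _ => key c
      _ ≤ _ := by
          rw [← Finset.sum_mul, Nat.factorial_succ, mul_comm]
          push_cast
          gcongr

/-- The sum over all maps `c : α → Fin n` of `n ^ (-|range c|)` is bounded uniformly in `n`. -/
theorem sum_inv_pow_card_range_le (α : Type*) [Fintype α] [DecidableEq α] (n : ℕ) :
    ∑ c : α → Fin n, ((n : ℝ)⁻¹) ^ (Set.range c).ncard ≤ ((Fintype.card α).factorial : ℝ) := by
  refine le_trans (le_of_eq ?_) (sum_inv_pow_card_range_le_factorial (Fintype.card α) n)
  refine Fintype.sum_equiv (Equiv.arrowCongr (Fintype.equivFin α) (Equiv.refl _)) _ _ fun c => ?_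
  congr 2
  ext x
  simp [Equiv.arrowCongr, (Fintype.equivFin α).symm.surjective.exists]

/-! ### Partial maps without infinite orbits, detected by a determinant -/

/-- Every orbit of the partial map `G` eventually leaves its domain. -/
def Dies {V : Type*} (G : V → Option V) : Prop :=
  ∀ v, ∃ k : ℕ, (fun o : Option V => o.bind G)^[k] (some v) = none

theorem bind_iterate_none {V : Type*} (G : V → Option V) (k : ℕ) :
    (fun o : Option V => o.bind G)^[k] none = none := by
  induction k with
  | zero => rfl
  | succ k ih => rw [Function.iterate_succ_apply]; exact ih

/-- The `0`-`1` matrix of a partial map. -/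
def partialMatrix {V : Type*} [DecidableEq V] (G : V → Option V) : Matrix V V ℝ :=
  Matrix.of fun v u => if G v = some u then 1 else 0

section
variable {V : Type*} [Fintype V] [DecidableEq V]

theorem partialMatrix_mulVec (G : V → Option V) (x : V → ℝ) (v : V) :
    (partialMatrix G).mulVec x v = (G v).elim 0 x := by
  unfold partialMatrix Matrix.mulVec dotProduct
  cases h : G v <;> simp [h]

theorem partialMatrix_pow_mulVec (G : V → Option V) (k : ℕ) (x : V → ℝ) (v : V) :
    (partialMatrix G ^ k).mulVec x v =
      ((fun o : Option V => o.bind G)^[k] (some v)).elim 0 x := by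
  induction k generalizing v with
  | zero => simp
  | succ k ih =>
    rw [pow_succ', ← Matrix.mulVec_mulVec, partialMatrix_mulVec, Function.iterate_succ_apply]
    cases h : G v with
    | none => simp [h, bind_iterate_none]
    | some u => simp [h, ih]

theorem partialMatrix_isNilpotent {G : V → Option V} (h : Dies G) :
    IsNilpotent (partialMatrix G) := by
  choose k hk using h
  -- The sum of the exit times bounds all of them at once.
  refine ⟨∑ v, k v, ?_⟩
  apply Matrix.ext_of_mulVec_single
  intro u
  ext v
  rw [partialMatrix_pow_mulVec, ← Finset.sum_erase_add _ _ (Finset.mem_univ v),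
    Function.iterate_add_apply, hk, bind_iterate_none]
  simp

/-- For nilpotent `A` the polynomial `det (1 - X A)` is a unit, hence constant; its value at `0` is
`1`, so its value at `1` is too. -/
theorem det_one_sub_partialMatrix_of_dies {G : V → Option V} (h : Dies G) :
    (1 - partialMatrix G).det = 1 := by
  have h1 := Matrix.isUnit_charpolyRev_of_isNilpotent (partialMatrix_isNilpotent h)
  obtain ⟨r, hr, hr'⟩ := Polynomial.isUnit_iff.1 h1
  have h2 := Matrix.eval_charpolyRev (M := partialMatrix G)
  rw [← hr', Polynomial.eval_C] at h2
  have h3 : Polynomial.eval 1 (partialMatrix G).charpolyRev = (1 - partialMatrix G).det := by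
    rw [Matrix.charpolyRev, ← Polynomial.coe_evalRingHom, RingHom.map_det]
    congr 1
    ext i j
    by_cases hij : i = j <;> simp [hij]
  rw [← h3, ← hr', Polynomial.eval_C, h2]

-- The indicator of the points with an infinite orbit is a nonzero vector fixed by the matrix.
open Classical in
theorem det_one_sub_partialMatrix_of_not_dies {G : V → Option V} (h : ¬ Dies G) :
    (1 - partialMatrix G).det = 0 := by
  let x : V → ℝ := fun v =>
    if ∃ k : ℕ, (fun o : Option V => o.bind G)^[k] (some v) = none then 0 else 1
  apply Matrix.exists_mulVec_eq_zero_iff.1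
  refine ⟨x, ?_, ?_⟩
  · intro hx
    apply h
    intro v
    by_contra hv
    have := congrFun hx v
    simp only [x, if_neg hv, Pi.zero_apply] at this
    exact one_ne_zero this
  · rw [Matrix.sub_mulVec, Matrix.one_mulVec, sub_eq_zero]
    ext v
    rw [partialMatrix_mulVec]
    have hs : (∃ k : ℕ, (fun o : Option V => o.bind G)^[k] (some v) = none) ↔
        ∃ k : ℕ, (fun o : Option V => o.bind G)^[k] (G v) = none := by
      constructor
      · rintro ⟨k, hk⟩
        refine ⟨k, ?_⟩
        have : (fun o : Option V => o.bind G)^[k + 1] (some v) = none := by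
          rw [Function.iterate_succ_apply', hk]; rfl
        rwa [Function.iterate_succ_apply] at this
      · rintro ⟨k, hk⟩
        exact ⟨k + 1, by rw [Function.iterate_succ_apply]; exact hk⟩
    cases hv : G v with
    | none =>
      rw [hv] at hs
      have : ∃ k : ℕ, (fun o : Option V => o.bind G)^[k] (some v) = none := hs.2 ⟨0, rfl⟩
      simp [x, if_pos this]
    | some u =>
      rw [hv] at hs
      simp only [x, hs, Option.elim]

open Classical in
/-- Counting the selections whose partial map has no infinite orbit by a determinant. -/
theorem sum_dies_eq_det {C : Type*} [Fintype C] (G : V → C → Option V) :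
    (∑ g : V → C, if Dies (fun v => G v (g v)) then (1 : ℝ) else 0) =
      (Matrix.of fun v u => ∑ c, ((1 : Matrix V V ℝ) v u - if G v c = some u then 1 else 0)).det := by
  -- Row `v` of `1 - partialMatrix` depends on the selection only through `g v`, so multilinearity
  -- in the rows turns the sum over selections into one determinant of row sums.
  have h1 := (Matrix.detRowAlternating (n := V) (R := ℝ)).toMultilinearMap.map_sum
    (fun (v : V) (c : C) => fun u => (1 : Matrix V V ℝ) v u - if G v c = some u then 1 else 0)
  have h2 : (Matrix.of fun v u =>
      ∑ c, ((1 : Matrix V V ℝ) v u - if G v c = some u then 1 else 0)) =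
      fun v => ∑ c, fun u => (1 : Matrix V V ℝ) v u - if G v c = some u then 1 else 0 := by
    ext v u
    simp [Finset.sum_apply]
  rw [h2]
  refine Eq.trans ?_ h1.symm
  refine Finset.sum_congr rfl fun g _ => ?_
  change _ = (1 - partialMatrix fun v => G v (g v)).det
  split_ifs with h
  · exact (det_one_sub_partialMatrix_of_dies h).symm
  · exact (det_one_sub_partialMatrix_of_not_dies h).symm
end

open Classical in
theorem ruleProb_eq_sum_of_existsUnique {n : ℕ} {ι : Type*} [Fintype ι] (A : ι → Set (CARule n))
    (E : Set (CARule n)) (h : ∀ f ∈ E, ∃! i, f ∈ A i) (h' : ∀ i, A i ⊆ E) :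
    ruleProb n E = ∑ i, ruleProb n (A i) := by
  simp_rw [ruleProb_eq_sum, ← Finset.sum_div]
  rw [Finset.sum_comm]
  congr 1
  refine Finset.sum_congr rfl fun f _ => ?_
  by_cases hf : f ∈ E
  · obtain ⟨i, hi, hu⟩ := h f hf
    rw [if_pos hf, Finset.sum_eq_single i, if_pos hi]
    · exact fun j _ hj => if_neg fun hj' => hj (hu j hj')
    · simp
  · rw [if_neg hf]
    exact (Finset.sum_eq_zero fun i _ => if_neg fun hi => hf (h' i hi)).symm

/-! ### The driven dynamics and the exact probability of collapse -/

section
variable {n : ℕ} {ι : Type*}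

/-- A column `a` of states, with time step `D`, drives the states of the next site. -/
def drivenStep (f : CARule n) (D : ι → ι) (a : ι → Fin n) : ι × Fin n → ι × Fin n :=
  fun p => (D p.1, f (a p.1) p.2)

/-- The driven dynamics eventually follows the graph of `c`, whatever the initial state. -/
def Collapses (f : CARule n) (D : ι → ι) (a c : ι → Fin n) : Prop :=
  ∀ p : ι × Fin n, ∃ k : ℕ,
    ((drivenStep f D a)^[k] p).2 = c ((drivenStep f D a)^[k] p).1

/-- The pairs (driver, driven state) that are off the graph of `c`. -/
abbrev OffGraph (c : ι → Fin n) : Type _ := {p : ι × Fin n // p.2 ≠ c p.1}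

/-- The driven dynamics off the graph of `c`, as a partial map depending on the value chosen by
the rule. -/
def offStep (D : ι → ι) (c : ι → Fin n) (v : OffGraph c) (z : Fin n) : Option (OffGraph c) :=
  if h : z ≠ c (D v.1.1) then some ⟨(D v.1.1, z), h⟩ else none

/-- The map `D` stopped at the points where the chosen value is `z₀`. -/
def stopStep [DecidableEq ι] (D : ι → ι) (z₀ : Fin n) (i : ι) (z : Fin n) : Option ι :=
  if z = z₀ then none else some (D i)

theorem offStep_eq_some_iff (D : ι → ι) (c : ι → Fin n) (v : OffGraph c) (z : Fin n)
    (u : OffGraph c) : offStep D c v z = some u ↔ D v.1.1 = u.1.1 ∧ z = u.1.2 := by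
  unfold offStep
  obtain ⟨⟨i, y⟩, hu⟩ := u
  constructor
  · split_ifs with h
    · intro h'
      have := congrArg Subtype.val (Option.some.inj h')
      simp only [Prod.mk.injEq] at this
      exact this
    · simp
  · rintro ⟨rfl, rfl⟩
    rw [dif_pos hu]

/-- The pins make the graph of `c` invariant, so reaching it once is the same as leaving the
off-graph points for good. -/
theorem collapses_iff_dies (f : CARule n) (D : ι → ι) (a c : ι → Fin n)
    (hpin : ∀ i, f (a i) (c i) = c (D i)) :
    Collapses f D a c ↔ Dies (fun v : OffGraph c => offStep D c v (f (a v.1.1) v.1.2)) := by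
  have key : ∀ (v : OffGraph c) (k : ℕ),
      (fun o : Option (OffGraph c) => o.bind fun v => offStep D c v (f (a v.1.1) v.1.2))^[k]
        (some v) = if h : ((drivenStep f D a)^[k] v.1).2 ≠ c ((drivenStep f D a)^[k] v.1).1
          then some ⟨_, h⟩ else none := by
    intro v k
    induction k with
    | zero => simp [v.2]
    | succ k ih =>
      rw [Function.iterate_succ_apply', ih]
      simp only [Function.iterate_succ_apply']
      set q := (drivenStep f D a)^[k] v.1
      by_cases hq : q.2 ≠ c q.1
      · rw [dif_pos hq]
        rfl
      · rw [dif_neg hq, dif_neg]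
        · rfl
        · push Not at hq ⊢
          simp only [drivenStep]
          rw [hq, hpin]
  constructor
  · intro h v
    obtain ⟨k, hk⟩ := h v.1
    exact ⟨k, by rw [key, dif_neg (not_not.2 hk)]⟩
  · intro h p
    by_cases hp : p.2 = c p.1
    · exact ⟨0, hp⟩
    · obtain ⟨k, hk⟩ := h ⟨p, hp⟩
      refine ⟨k, ?_⟩
      by_contra hne
      rw [key, dif_pos hne] at hk
      cases hk

variable [Fintype ι]

theorem card_offGraph (c : ι → Fin n) :
    Fintype.card (OffGraph c) + Fintype.card ι = Fintype.card ι * n := by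
  have h1 : Fintype.card {p : ι × Fin n // p.2 = c p.1} = Fintype.card ι := by
    refine Fintype.card_congr ⟨fun p => p.1.1, fun i => ⟨(i, c i), rfl⟩, ?_, fun _ => rfl⟩
    rintro ⟨⟨i, y⟩, h⟩
    simp only at h
    simp [h]
  have h2 := Fintype.card_subtype_compl (fun p : ι × Fin n => p.2 = c p.1)
  have h3 := Fintype.card_subtype_le (fun p : ι × Fin n => p.2 = c p.1)
  have h4 : Fintype.card (OffGraph c) = Fintype.card {p : ι × Fin n // ¬ p.2 = c p.1} := rfl
  rw [h4, h2]
  rw [h1] at h3 ⊢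
  rw [Fintype.card_prod, Fintype.card_fin] at h3 ⊢
  omega

variable [DecidableEq ι]

theorem sum_offGraph_fst (c : ι → Fin n) (i : ι) :
    (∑ q : OffGraph c, if q.1.1 = i then (1 : ℝ) else 0) = (n : ℝ) - 1 := by
  have h1 : (∑ q : OffGraph c, if q.1.1 = i then (1 : ℝ) else 0) =
      ∑ q ∈ (Finset.univ.filter fun q : ι × Fin n => q.2 ≠ c q.1),
        if q.1 = i then (1 : ℝ) else 0 := by
    rw [Finset.sum_subtype (p := fun q : ι × Fin n => q.2 ≠ c q.1)]
    simp
  rw [h1, Finset.sum_filter, Fintype.sum_prod_type, Finset.sum_eq_single i]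
  · simp only [if_true]
    have h2 : ∀ y : Fin n, (if y ≠ c i then (1 : ℝ) else 0) = 1 - if y = c i then 1 else 0 := by
      intro y; by_cases h : y = c i <;> simp [h]
    simp_rw [h2]
    simp
  · intro j _ hj
    simp [hj]
  · simp

-- Averaged over a uniform value, the off-graph transitions depend only on the driver, so the
-- averaged matrix factors through `ι` as `X * Y`. Exchanging the factors leaves a matrix on `ι`
-- that moves `i` to `D i` with weight `(n - 1)/n`, which is the averaged matrix of `D` stopped at
-- the points where an independent value equals `z₀`.
open Classical in
theorem sum_dies_offStep (hn : 0 < n) (D : ι → ι) (c : ι → Fin n) (z₀ : Fin n) :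
    (∑ g : OffGraph c → Fin n, if Dies (fun v => offStep D c v (g v)) then (1 : ℝ) else 0) *
        (n : ℝ) ^ Fintype.card ι =
      (n : ℝ) ^ Fintype.card (OffGraph c) *
        ∑ g : ι → Fin n, if Dies (fun i => stopStep D z₀ i (g i)) then (1 : ℝ) else 0 := by
  have hn' : (n : ℝ) ≠ 0 := by positivity
  let X : Matrix (OffGraph c) ι ℝ := Matrix.of fun p j => if D p.1.1 = j then (n : ℝ)⁻¹ else 0
  let Y : Matrix ι (OffGraph c) ℝ := Matrix.of fun j q => if q.1.1 = j then 1 else 0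
  rw [sum_dies_eq_det, sum_dies_eq_det]
  have h1 : (Matrix.of fun v u : OffGraph c => ∑ z, ((1 : Matrix (OffGraph c) (OffGraph c) ℝ) v u -
      if offStep D c v z = some u then 1 else 0)) = (n : ℝ) • (1 - X * Y) := by
    ext v u
    simp only [Matrix.of_apply, Matrix.smul_apply, Matrix.sub_apply, Matrix.mul_apply, X, Y,
      offStep_eq_some_iff, smul_eq_mul, Finset.sum_sub_distrib, mul_sub]
    congr 1
    · simp
    · by_cases h : D v.1.1 = u.1.1
      · simp [h, hn']
      · simp [h]
  have h2 : (Matrix.of fun v u : ι => ∑ z, ((1 : Matrix ι ι ℝ) v u -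
      if stopStep D z₀ v z = some u then 1 else 0)) = (n : ℝ) • (1 - Y * X) := by
    ext i j
    simp only [Matrix.of_apply, Matrix.smul_apply, Matrix.sub_apply, Matrix.mul_apply, X, Y,
      smul_eq_mul, Finset.sum_sub_distrib, mul_sub]
    congr 1
    · simp
    · have h3 : (∑ q : OffGraph c, (if q.1.1 = i then (1 : ℝ) else 0) *
          if D q.1.1 = j then (n : ℝ)⁻¹ else 0) =
          ∑ q : OffGraph c, (if q.1.1 = i then (1 : ℝ) else 0) *
            if D i = j then (n : ℝ)⁻¹ else 0 := by
        refine Finset.sum_congr rfl fun q _ => ?_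
        by_cases hq : q.1.1 = i <;> simp [hq]
      rw [h3, ← Finset.sum_mul, sum_offGraph_fst]
      by_cases h : D i = j
      · have h4 : ∀ z : Fin n, (if stopStep D z₀ i z = some j then (1 : ℝ) else 0) =
            1 - if z = z₀ then 1 else 0 := by
          intro z
          unfold stopStep
          by_cases hz : z = z₀ <;> simp [hz, h]
        simp_rw [h4]
        simp [h]
        field_simp
      · have h4 : ∀ z : Fin n, ¬ stopStep D z₀ i z = some j := by
          intro z
          unfold stopStep
          by_cases hz : z = z₀ <;> simp [hz, h]
        simp [h4, h]
  rw [h1, h2, Matrix.det_smul, Matrix.det_smul, Matrix.det_one_sub_mul_comm]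
  ring

open Classical in
/-- The probability that a rule has prescribed values along the graph of `c` and collapses onto
it, for injective `a`. -/
theorem ruleProb_pinned_collapses (hn : 0 < n) (D : ι → ι) (a c : ι → Fin n)
    (ha : Function.Injective a) (z₀ : Fin n) :
    ruleProb n {f | (∀ i, f (a i) (c i) = c (D i)) ∧ Collapses f D a c} =
      ((n : ℝ)⁻¹) ^ (2 * Fintype.card ι) *
        ∑ g : ι → Fin n, if Dies (fun i => stopStep D z₀ i (g i)) then (1 : ℝ) else 0 := by
  have hn' : (n : ℝ) ≠ 0 := by positivity
  -- Split according to the values of the rule off the graph. Since `a` is injective, all pairs `(a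
  -- i, y)` are different entries of the rule, so each part is empty or pins exactly `card ι * n`
  -- entries.
  let B : (OffGraph c → Fin n) → Set (CARule n) := fun g =>
    {f | Dies (fun v => offStep D c v (g v)) ∧ (∀ i, f (a i) (c i) = c (D i)) ∧
      ∀ v : OffGraph c, f (a v.1.1) v.1.2 = g v}
  have h1 : ruleProb n {f | (∀ i, f (a i) (c i) = c (D i)) ∧ Collapses f D a c} =
      ∑ g, ruleProb n (B g) := by
    apply ruleProb_eq_sum_of_existsUnique
    · rintro f ⟨hf, hc⟩
      refine ⟨fun v => f (a v.1.1) v.1.2, ⟨(collapses_iff_dies f D a c hf).1 hc, hf, fun _ => rfl⟩,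
        fun g hg => (funext hg.2.2).symm⟩
    · rintro g f ⟨h1, h2, h3⟩
      refine ⟨h2, (collapses_iff_dies f D a c h2).2 ?_⟩
      simp_rw [h3]
      exact h1
  have hinj : Function.Injective (fun p : ι × Fin n => (a p.1, p.2)) := by
    rintro ⟨i, y⟩ ⟨j, z⟩ h
    simp only [Prod.mk.injEq] at h
    rw [ha h.1, h.2]
  have h2 : ∀ g, ruleProb n (B g) = ((n : ℝ)⁻¹) ^ (Fintype.card ι * n) *
      if Dies (fun v => offStep D c v (g v)) then (1 : ℝ) else 0 := by
    intro g
    split_ifs with hg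
    · let G : ι × Fin n → Fin n := fun p => if h : p.2 ≠ c p.1 then g ⟨p, h⟩ else c (D p.1)
      have h3 := ruleProb_pinned hn
        (Finset.univ.image (fun p : ι × Fin n => (a p.1, p.2)))
        (Function.extend (fun p : ι × Fin n => (a p.1, p.2)) G (fun _ => z₀))
      rw [Finset.card_image_of_injective _ hinj, Finset.card_univ, Fintype.card_prod,
        Fintype.card_fin] at h3
      rw [mul_one, ← h3]
      congr 1
      ext f
      simp only [B, Set.mem_ofPred_eq, hg, true_and, Finset.mem_image, Finset.mem_univ,
        forall_exists_index, forall_apply_eq_imp_iff, hinj.extend_apply]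
      constructor
      · rintro ⟨h4, h5⟩ p
        by_cases hp : p.2 ≠ c p.1
        · simp only [G, dif_pos hp]
          exact h5 ⟨p, hp⟩
        · simp only [G, dif_neg hp]
          rw [not_not.1 hp]
          exact h4 _
      · intro h4
        constructor
        · intro i
          simpa [G] using h4 (i, c i)
        · intro v
          have := h4 v.1
          simp only [G, dif_pos v.2] at this
          exact this
    · have : B g = ∅ := by
        ext f
        simp [B, hg]
      rw [this, ruleProb_empty, mul_zero]
  rw [h1]
  simp_rw [h2]
  rw [← Finset.mul_sum]
  have h3 := sum_dies_offStep hn D c z₀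
  have h4 := card_offGraph c
  rw [← h4]
  have h5 : ∀ x y : ℝ, x * (n : ℝ) ^ Fintype.card ι = (n : ℝ) ^ Fintype.card (OffGraph c) * y →
      ((n : ℝ)⁻¹) ^ (Fintype.card (OffGraph c) + Fintype.card ι) * x =
        ((n : ℝ)⁻¹) ^ (2 * Fintype.card ι) * y := by
    intro x y hxy
    rw [inv_pow, inv_pow, pow_add, two_mul, pow_add]
    field_simp
    linarith
  exact h5 _ _ h3
end

section
variable {n : ℕ} {ι : Type*} [DecidableEq ι]

theorem stopStep_bind_iterate (D : ι → ι) (z₀ : Fin n) (g : ι → Fin n) (i : ι) (k : ℕ)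
    (h : ∀ l < k, g (D^[l] i) ≠ z₀) :
    (fun o : Option ι => o.bind fun i => stopStep D z₀ i (g i))^[k] (some i) =
      some (D^[k] i) := by
  induction k with
  | zero => rfl
  | succ k ih =>
    rw [Function.iterate_succ_apply', ih fun l hl => h l (by omega), Function.iterate_succ_apply']
    simp [stopStep, h k (by omega)]

theorem dies_stopStep_iff (D : ι → ι) (z₀ : Fin n) (g : ι → Fin n) :
    Dies (fun i => stopStep D z₀ i (g i)) ↔ ∀ i, ∃ k, g (D^[k] i) = z₀ := by
  classical
  constructor
  · intro h i
    by_contra! hi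
    obtain ⟨k, hk⟩ := h i
    rw [stopStep_bind_iterate D z₀ g i k fun l _ => hi l] at hk
    cases hk
  · intro h i
    refine ⟨Nat.find (h i) + 1, ?_⟩
    rw [Function.iterate_succ_apply', stopStep_bind_iterate D z₀ g i _
      fun l hl => Nat.find_min (h i) hl]
    simp [stopStep, Nat.find_spec (h i)]

variable [Fintype ι]

open Classical in
theorem sum_indicator_eq_on (hn : 0 < n) (S : Finset ι) (z₀ : Fin n) :
    (∑ g : ι → Fin n, if ∀ i ∈ S, g i = z₀ then (1 : ℝ) else 0) =
      (n : ℝ) ^ Fintype.card ι * ((n : ℝ)⁻¹) ^ S.card := by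
  have hn' : (n : ℝ) ≠ 0 := by positivity
  have h1 : (Finset.univ.filter fun g : ι → Fin n => ∀ i ∈ S, g i = z₀) =
      Fintype.piFinset fun i => if i ∈ S then {z₀} else Finset.univ := by
    ext g
    simp only [Finset.mem_filter, Finset.mem_univ, true_and, Fintype.mem_piFinset]
    refine forall_congr' fun i => ?_
    by_cases hi : i ∈ S <;> simp [hi]
  rw [Finset.sum_boole, h1, Fintype.card_piFinset]
  have h2 : ∀ i, ((if i ∈ S then {z₀} else (Finset.univ : Finset (Fin n))).card : ℝ) =
      n * if i ∈ S then (n : ℝ)⁻¹ else 1 := by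
    intro i; split_ifs <;> simp [hn']
  push_cast
  simp_rw [h2]
  rw [Finset.prod_mul_distrib]
  simp

-- Each of the two orbits must contain a point with value `z₀`, and these points differ. A union
-- bound over pairs of points gives `n ^ (-2)` per pair.
open Classical in
theorem sum_dies_stopStep_le (hn : 0 < n) (D : ι → ι) (z₀ : Fin n) (i j : ι)
    (hij : ∀ k l : ℕ, D^[k] i ≠ D^[l] j) :
    (∑ g : ι → Fin n, if Dies (fun i => stopStep D z₀ i (g i)) then (1 : ℝ) else 0) ≤
      (Fintype.card ι : ℝ) ^ 2 * (n : ℝ) ^ Fintype.card ι * ((n : ℝ)⁻¹) ^ 2 := by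
  have h1 : ∀ g : ι → Fin n, (if Dies (fun i => stopStep D z₀ i (g i)) then (1 : ℝ) else 0) ≤
      ∑ p : ι × ι, if p.1 ≠ p.2 then
        (if ∀ i ∈ ({p.1, p.2} : Finset ι), g i = z₀ then (1 : ℝ) else 0) else 0 := by
    intro g
    have h0 : ∀ p : ι × ι, 0 ≤ if p.1 ≠ p.2 then
        (if ∀ i ∈ ({p.1, p.2} : Finset ι), g i = z₀ then (1 : ℝ) else 0) else 0 := by
      intro p; split_ifs <;> norm_num
    split_ifs with h
    · rw [dies_stopStep_iff] at h
      obtain ⟨k, hk⟩ := h i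
      obtain ⟨l, hl⟩ := h j
      refine le_trans (le_of_eq ?_) (Finset.single_le_sum (fun p _ => h0 p)
        (Finset.mem_univ (D^[k] i, D^[l] j)))
      rw [if_pos (hij k l), if_pos]
      simp [hk, hl]
    · exact Finset.sum_nonneg fun p _ => h0 p
  refine (Finset.sum_le_sum fun g _ => h1 g).trans ?_
  rw [Finset.sum_comm]
  have h2 : ∀ p : ι × ι, (∑ g : ι → Fin n, if p.1 ≠ p.2 then
        (if ∀ i ∈ ({p.1, p.2} : Finset ι), g i = z₀ then (1 : ℝ) else 0) else 0) ≤
        (n : ℝ) ^ Fintype.card ι * ((n : ℝ)⁻¹) ^ 2 := by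
    intro p
    by_cases hp : p.1 ≠ p.2
    · simp only [if_pos hp]
      rw [sum_indicator_eq_on hn, Finset.card_pair hp]
    · simp only [if_neg hp, Finset.sum_const_zero]
      positivity
  refine (Finset.sum_le_sum fun p _ => h2 p).trans ?_
  simp [sq, mul_assoc]

/-- Two disjoint orbits of drivers: collapsing costs a factor `n ^ (-2)`. -/
theorem ruleProb_pinned_collapses_le (hn : 0 < n) (D : ι → ι) (a c : ι → Fin n)
    (ha : Function.Injective a) (i j : ι) (hij : ∀ k l : ℕ, D^[k] i ≠ D^[l] j) :
    ruleProb n {f | (∀ i, f (a i) (c i) = c (D i)) ∧ Collapses f D a c} ≤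
      (Fintype.card ι : ℝ) ^ 2 * ((n : ℝ)⁻¹) ^ (Fintype.card ι + 2) := by
  have hn' : (n : ℝ) ≠ 0 := by positivity
  rw [ruleProb_pinned_collapses hn D a c ha ⟨0, hn⟩]
  refine (mul_le_mul_of_nonneg_left (sum_dies_stopStep_le hn D ⟨0, hn⟩ i j hij)
    (by positivity)).trans (le_of_eq ?_)
  rw [two_mul, pow_add, pow_add]
  have : ((n : ℝ)⁻¹) ^ Fintype.card ι * (n : ℝ) ^ Fintype.card ι = 1 := by
    rw [← mul_pow, inv_mul_cancel₀ hn', one_pow]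
  linear_combination (Fintype.card ι : ℝ) ^ 2 * ((n : ℝ)⁻¹) ^ Fintype.card ι *
    ((n : ℝ)⁻¹) ^ 2 * this
end

/-- The probability that a rule has prescribed values along the graph of `c` and collapses onto
it, when the drivers form a single cycle. -/
theorem ruleProb_cycle_collapses {n τ : ℕ} [NeZero τ] (hn : 0 < n) (a c : ZMod τ → Fin n)
    (ha : Function.Injective a) :
    ruleProb n {f | (∀ i, f (a i) (c i) = c (i + 1)) ∧ Collapses f (· + 1) a c} =
      ((n : ℝ)⁻¹) ^ (2 * τ) * ((n : ℝ) ^ τ - ((n : ℝ) - 1) ^ τ) := by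
  classical
  rw [ruleProb_pinned_collapses hn (· + 1) a c ha ⟨0, hn⟩, ZMod.card]
  congr 1
  -- On a single cycle one stopping point suffices, so only the `(n - 1) ^ τ` selections without any
  -- are excluded.
  have h1 : ∀ g : ZMod τ → Fin n, Dies (fun i => stopStep (· + 1) ⟨0, hn⟩ i (g i)) ↔
      ¬ ∀ i, g i ≠ ⟨0, hn⟩ := by
    intro g
    rw [dies_stopStep_iff]
    push Not
    constructor
    · intro h
      obtain ⟨k, hk⟩ := h 0
      exact ⟨_, hk⟩
    · rintro ⟨i, hi⟩ j
      refine ⟨(i - j).val, ?_⟩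
      rw [add_right_iterate]
      simpa using hi
  simp_rw [h1]
  have h2 : ∀ g : ZMod τ → Fin n, (if ¬ ∀ i, g i ≠ (⟨0, hn⟩ : Fin n) then (1 : ℝ) else 0) =
      1 - if ∀ i, g i ≠ (⟨0, hn⟩ : Fin n) then (1 : ℝ) else 0 := by
    intro g; by_cases h : ∀ i, g i ≠ (⟨0, hn⟩ : Fin n)
    · rw [if_neg (not_not.2 h), if_pos h, sub_self]
    · rw [if_pos h, if_neg h, sub_zero]
  simp_rw [h2]
  rw [Finset.sum_sub_distrib]
  congr 1
  · simp
  · rw [Finset.sum_boole]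
    have h3 : (Finset.univ.filter fun g : ZMod τ → Fin n => ∀ i, g i ≠ ⟨0, hn⟩) =
        Fintype.piFinset fun _ => Finset.univ.erase ⟨0, hn⟩ := by
      ext g; simp [Fintype.mem_piFinset]
    rw [h3, Fintype.card_piFinset]
    simp [Nat.cast_sub (Nat.succ_le_of_lt hn)]

/-! ### Absorption by boundedly many states is unlikely: a switching argument -/

section
variable {n : ℕ}

/-- The trajectory of the state `y` driven by the sequence of states `a`. -/
def traj (f : CARule n) (a : ℕ → Fin n) (y : Fin n) : ℕ → Fin n
  | 0 => y
  | t + 1 => f (a t) (traj f a y t)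

theorem traj_add (f : CARule n) (a : ℕ → Fin n) (y : Fin n) (s t : ℕ) :
    traj f a y (s + t) = traj f (fun i => a (s + i)) (traj f a y s) t := by
  induction t with
  | zero => rfl
  | succ t ih => rw [← add_assoc, traj, ih, traj]

/-- The rule `f` with the value at `(x, z)` replaced by `v`. -/
def updateRule (f : CARule n) (x z v : Fin n) : CARule n :=
  fun x' z' => if x' = x ∧ z' = z then v else f x' z'

theorem traj_updateRule (f : CARule n) (a : ℕ → Fin n) (x y z v : Fin n) (t : ℕ)
    (h : ∀ s < t, traj f a y s ≠ z) : traj (updateRule f x z v) a y t = traj f a y t := by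
  induction t with
  | zero => rfl
  | succ t ih =>
    rw [traj, traj, ih fun s hs => h s (by omega), updateRule, if_neg]
    exact fun h' => h t (by omega) h'.2

theorem updateRule_updateRule_self (f : CARule n) (x z v : Fin n) :
    updateRule (updateRule f x z v) x z (f x z) = f := by
  funext x' z'
  unfold updateRule
  split_ifs with h
  · rw [h.1, h.2]
  · rfl

/-- `y` starts a cycle of length `k * τ` that has no repeated state and avoids `B`. -/
structure AvoidingCycle (f : CARule n) (a : ℕ → Fin n) (B : Finset (Fin n)) (τ k : ℕ)
    (y : Fin n) : Prop where
  return_eq : traj f a y (k * τ) = y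
  injOn : Set.InjOn (traj f a y) (Set.Iio (k * τ))
  avoid : ∀ t < k * τ, traj f a y t ∉ B

theorem driver_add_mul {a : ℕ → Fin n} {τ : ℕ} (ha : ∀ t, a (t + τ) = a t) (k t : ℕ) :
    a (t + k * τ) = a t := by
  induction k with
  | zero => simp
  | succ k ih => rw [Nat.succ_mul, ← add_assoc, ha, ih]

theorem driver_congr {a : ℕ → Fin n} {τ : ℕ} (ha : ∀ t, a (t + τ) = a t) {s t : ℕ}
    (h : s % τ = t % τ) : a s = a t := by
  rw [← Nat.mod_add_div' s τ, ← Nat.mod_add_div' t τ, driver_add_mul ha, driver_add_mul ha, h]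

theorem driver_shift_congr {a : ℕ → Fin n} {τ : ℕ} (ha : ∀ t, a (t + τ) = a t) {s t : ℕ}
    (h : s % τ = t % τ) : (fun i => a (s + i)) = fun i => a (t + i) :=
  funext fun i => driver_congr ha (Nat.ModEq.add_right i h)

namespace AvoidingCycle
variable {f : CARule n} {a : ℕ → Fin n} {B : Finset (Fin n)} {τ k k' : ℕ} {y y' : Fin n}

theorem periodic (h : AvoidingCycle f a B τ k y) (ha : ∀ t, a (t + τ) = a t) :
    Function.Periodic (traj f a y) (k * τ) := by
  intro t
  rw [add_comm, traj_add, h.return_eq]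
  congr 1
  funext i
  rw [add_comm, driver_add_mul ha]

theorem modEq (h : AvoidingCycle f a B τ k y) (ha : ∀ t, a (t + τ) = a t) (hk : 0 < k * τ)
    {s t : ℕ} (hst : traj f a y s = traj f a y t) : s ≡ t [MOD k * τ] := by
  rw [← (h.periodic ha).map_mod_nat s, ← (h.periodic ha).map_mod_nat t] at hst
  exact h.injOn (Nat.mod_lt _ hk) (Nat.mod_lt _ hk) hst

/-- After meeting at equal driver phases the trajectories coincide, so the second also returns after
`k * τ` steps, which must be a multiple of its own length. -/
theorem dvd_of_meet (h : AvoidingCycle f a B τ k y) (h' : AvoidingCycle f a B τ k' y')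
    (ha : ∀ t, a (t + τ) = a t) (hτ : 0 < τ) (hk' : 0 < k') {t t' : ℕ} (ht : t % τ = t' % τ)
    (he : traj f a y t = traj f a y' t') : k' ∣ k := by
  have h1 : traj f a y' (t' + k * τ) = traj f a y' t' := by
    rw [traj_add, ← he, ← driver_shift_congr ha ht, ← traj_add, h.periodic ha]
  have h2 := h'.modEq ha (Nat.mul_pos hk' hτ) h1
  have h3 : k' * τ ∣ k * τ := by
    have := (Nat.modEq_iff_dvd' (Nat.le_add_right t' (k * τ))).1 h2.symm
    rwa [Nat.add_sub_cancel_left] at this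
  exact Nat.dvd_of_mul_dvd_mul_right hτ h3

theorem eq_of_meet (h : AvoidingCycle f a B τ k y) (h' : AvoidingCycle f a B τ k y')
    {t : ℕ} (ht : t < k * τ) (he : traj f a y t = traj f a y' t) : y = y' := by
  have h1 : t + (k * τ - t) = k * τ := by omega
  rw [← h.return_eq, ← h'.return_eq, ← h1, traj_add, traj_add, he]

end AvoidingCycle

/-- Cycles through a common state, weighted by the inverses of their lengths. -/
theorem sum_avoidingCycle_le {f : CARule n} {a : ℕ → Fin n} {B : Finset (Fin n)} {τ : ℕ}
    (ha : ∀ t, a (t + τ) = a t) (hτ : 0 < τ) (Z : Finset (ℕ × Fin n)) (e : Fin n)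
    (hZ : ∀ z ∈ Z, AvoidingCycle f a B τ (z.1 + 1) z.2)
    (he : ∀ z ∈ Z, ∃ t < (z.1 + 1) * τ, traj f a z.2 t = e) :
    ∑ z ∈ Z, (1 : ℝ) / ((z.1 : ℝ) + 1) ≤ τ := by
  classical
  choose! T hT1 hT2 using he
  have hmaps : ∀ z ∈ Z, T z % τ ∈ Finset.range τ := fun z _ =>
    Finset.mem_range.2 (Nat.mod_lt _ hτ)
  rw [← Finset.sum_fiberwise_of_maps_to hmaps]
  -- Cycles passing through `e` at the same phase are rotations of a single cycle: they share a
  -- length `k * τ`, and each is determined by the number of periods before `e`. At most `k` of them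
  -- exist, with weight `1/k` each.
  have hfib : ∀ i ∈ Finset.range τ,
      ∑ z ∈ Z with T z % τ = i, (1 : ℝ) / ((z.1 : ℝ) + 1) ≤ 1 := by
    intro i _
    by_cases hne : (Z.filter fun z => T z % τ = i).Nonempty
    · obtain ⟨z₀, hz₀⟩ := hne
      rw [Finset.mem_filter] at hz₀
      have hk : ∀ z ∈ Z.filter (fun z => T z % τ = i), z.1 = z₀.1 := by
        intro z hz
        rw [Finset.mem_filter] at hz
        have h1 := (hZ z hz.1).dvd_of_meet (hZ z₀ hz₀.1) ha hτ (Nat.succ_pos _)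
          (hz.2.trans hz₀.2.symm) ((hT2 z hz.1).trans (hT2 z₀ hz₀.1).symm)
        have h2 := (hZ z₀ hz₀.1).dvd_of_meet (hZ z hz.1) ha hτ (Nat.succ_pos _)
          (hz₀.2.trans hz.2.symm) ((hT2 z₀ hz₀.1).trans (hT2 z hz.1).symm)
        exact Nat.succ_injective (Nat.dvd_antisymm h2 h1)
      have hcard : (Z.filter fun z => T z % τ = i).card ≤ z₀.1 + 1 := by
        rw [← Finset.card_range (z₀.1 + 1)]
        apply Finset.card_le_card_of_injOn (fun z => T z / τ)
        · intro z hz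
          have hz' := hk z hz
          rw [Finset.mem_coe, Finset.mem_filter] at hz
          have := hT1 z hz.1
          rw [hz'] at this
          exact Finset.mem_coe.2 (Finset.mem_range.2
            (Nat.div_lt_of_lt_mul (by rwa [mul_comm] at this)))
        · intro z hz w hw hzw
          have hz' := hk z hz
          have hw' := hk w hw
          rw [Finset.mem_coe, Finset.mem_filter] at hz hw
          have hTT : T z = T w := by
            rw [← Nat.mod_add_div (T z) τ, ← Nat.mod_add_div (T w) τ, hz.2, hw.2]
            simp only at hzw
            rw [hzw]
          have h1 := hZ z hz.1
          have h2 := hZ w hw.1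
          rw [hz', ← hw'] at h1
          have h3 := h1.eq_of_meet h2 (hTT ▸ hT1 w hw.1)
            ((hT2 z hz.1).trans (hTT ▸ (hT2 w hw.1).symm))
          exact Prod.ext (hz'.trans hw'.symm) h3
      calc ∑ z ∈ Z with T z % τ = i, (1 : ℝ) / ((z.1 : ℝ) + 1)
          = ∑ z ∈ Z with T z % τ = i, (1 : ℝ) / ((z₀.1 : ℝ) + 1) :=
            Finset.sum_congr rfl fun z hz => by rw [hk z hz]
        _ = ((Z.filter fun z => T z % τ = i).card : ℝ) * (1 / ((z₀.1 : ℝ) + 1)) := by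
            rw [Finset.sum_const, nsmul_eq_mul]
        _ ≤ ((z₀.1 : ℝ) + 1) * (1 / ((z₀.1 : ℝ) + 1)) := by
            gcongr
            exact_mod_cast hcard
        _ = 1 := by field_simp
    · rw [Finset.not_nonempty_iff_eq_empty.1 hne]
      simp
  refine (Finset.sum_le_sum hfib).trans ?_
  simp

/-- The rules with prescribed values `h` on `E`. -/
def pinnedRules (E : Finset (Fin n × Fin n)) (h : Fin n × Fin n → Fin n) : Set (CARule n) :=
  {f | ∀ e ∈ E, f e.1 e.2 = h e}

/-- The rules for which every trajectory driven by `a` hits `B`. -/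
def absorbedRules (a : ℕ → Fin n) (B : Finset (Fin n)) : Set (CARule n) :=
  {f | ∀ y, ∃ t, traj f a y t ∈ B}

/-- The rules for which the trajectory of `y` up to time `m` has no repetition and avoids `B`. -/
def freeRules (a : ℕ → Fin n) (B : Finset (Fin n)) (m : ℕ) (y : Fin n) : Set (CARule n) :=
  {f | Set.InjOn (traj f a y) (Set.Iic m) ∧ ∀ t ≤ m, traj f a y t ∉ B}

/-- A cycle that misses `z` survives a change of the rule at `z`, and would then never be absorbed.
-/
theorem AvoidingCycle.meets_of_absorbed {f : CARule n} {a : ℕ → Fin n} {B : Finset (Fin n)}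
    {τ k : ℕ} {y x z v : Fin n} (h : AvoidingCycle f a B τ k y) (ha : ∀ t, a (t + τ) = a t)
    (hk : 0 < k * τ) (hf : updateRule f x z v ∈ absorbedRules a B) :
    ∃ t < k * τ, traj f a y t = z := by
  by_contra! hne
  have hne' : ∀ t, traj f a y t ≠ z := by
    intro t
    rw [← (h.periodic ha).map_mod_nat t]
    exact hne _ (Nat.mod_lt _ hk)
  obtain ⟨t, ht⟩ := hf y
  rw [traj_updateRule f a x y z v t fun s _ => hne' s, ← (h.periodic ha).map_mod_nat t] at ht
  exact h.avoid _ (Nat.mod_lt _ hk) ht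

/-- Redirecting a free trajectory to its initial state closes an avoiding cycle. -/
theorem avoidingCycle_updateRule {f : CARule n} {a : ℕ → Fin n} {B : Finset (Fin n)}
    {τ k m : ℕ} {y : Fin n} (hk : 0 < k * τ) (hm : k * τ ≤ m) (hf : f ∈ freeRules a B m y) :
    AvoidingCycle (updateRule f (a (k * τ - 1)) (traj f a y (k * τ - 1)) y) a B τ k y ∧
      ∀ t < k * τ, traj (updateRule f (a (k * τ - 1)) (traj f a y (k * τ - 1)) y) a y t =
        traj f a y t := by
  have h1 : ∀ t < k * τ, traj (updateRule f (a (k * τ - 1)) (traj f a y (k * τ - 1)) y) a y t =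
        traj f a y t := by
    intro t ht
    apply traj_updateRule
    intro s hs heq
    have := hf.1 (show s ≤ m by omega) (show k * τ - 1 ≤ m by omega) heq
    omega
  refine ⟨⟨?_, ?_, ?_⟩, h1⟩
  · obtain ⟨j, hj⟩ : ∃ j, k * τ = j + 1 := ⟨k * τ - 1, by omega⟩
    have h2 := h1 j (by omega)
    rw [hj] at h2 ⊢
    simp only [Nat.add_sub_cancel] at h2 ⊢
    rw [traj, h2]
    simp [updateRule]
  · intro s hs t ht hst
    rw [h1 s hs, h1 t ht] at hst
    rw [Set.mem_Iio] at hs ht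
    exact hf.1 (show s ≤ m by omega) (show t ≤ m by omega) hst
  · intro t ht
    rw [h1 t ht]
    exact hf.2 t (by omega)

-- Take a rule that absorbs everything and a start `y` with a long free trajectory. For each `k <
-- L`, redirecting the value met just before time `(k + 1) * τ` back to `y` closes a cycle;
-- remembering the old value costs a factor `n` and makes the switch reversible. A switched rule is
-- one change away from an absorbing rule, so all its avoiding cycles meet a common state and their
-- weights `1/(k + 1)` sum to at most `τ`. Summing over `k` produces the harmonic factor.
open Classical in
theorem card_absorbed_free_mul_le {a : ℕ → Fin n} {τ : ℕ} (ha : ∀ t, a (t + τ) = a t)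
    (hτ : 0 < τ) (L : ℕ) (E : Finset (Fin n × Fin n)) (h : Fin n × Fin n → Fin n)
    (B : Finset (Fin n)) (hEB : ∀ e ∈ E, e.2 ∈ B) :
    ((Finset.univ.filter fun p : CARule n × Fin n => p.1 ∈ pinnedRules E h ∧
        p.1 ∈ absorbedRules a B ∧ p.1 ∈ freeRules a B (L * τ) p.2).card : ℝ) *
        ∑ k ∈ Finset.range L, (1 : ℝ) / ((k : ℝ) + 1) ≤
      n * τ * (Finset.univ.filter fun f : CARule n => f ∈ pinnedRules E h).card := by
  set RG := Finset.univ.filter fun p : CARule n × Fin n => p.1 ∈ pinnedRules E h ∧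
        p.1 ∈ absorbedRules a B ∧ p.1 ∈ freeRules a B (L * τ) p.2 with hRG
  set Ω := Finset.univ.filter fun f : CARule n => f ∈ pinnedRules E h with hΩ
  -- The cycles of a rule that can be opened by one change to make the rule absorbing: the possible
  -- outcomes of the switch. The length is `z.1 + 1` periods.
  let Z : CARule n → Finset (ℕ × Fin n) := fun f =>
    (Finset.range L ×ˢ Finset.univ).filter fun z =>
      AvoidingCycle f a B τ (z.1 + 1) z.2 ∧ ∃ v, updateRule f (a ((z.1 + 1) * τ - 1))
        (traj f a z.2 ((z.1 + 1) * τ - 1)) v ∈ absorbedRules a B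
  have hZsum : ∀ f, ∑ z ∈ Z f, (1 : ℝ) / ((z.1 : ℝ) + 1) ≤ τ := by
    intro f
    by_cases hne : (Z f).Nonempty
    · obtain ⟨z₀, hz₀⟩ := hne
      obtain ⟨_, _, v, hv⟩ := Finset.mem_filter.1 hz₀
      refine sum_avoidingCycle_le ha hτ (Z f) (traj f a z₀.2 ((z₀.1 + 1) * τ - 1))
        (fun z hz => (Finset.mem_filter.1 hz).2.1) fun z hz => ?_
      exact (Finset.mem_filter.1 hz).2.1.meets_of_absorbed ha (Nat.mul_pos (Nat.succ_pos _) hτ) hv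
    · rw [Finset.not_nonempty_iff_eq_empty.1 hne]
      simp
  have hcard : ∀ k ∈ Finset.range L, (RG.card : ℝ) ≤
      n * ∑ f ∈ Ω, ((Finset.univ.filter fun y => (k, y) ∈ Z f).card : ℝ) := by
    intro k hk
    rw [Finset.mem_range] at hk
    have hpos : 0 < (k + 1) * τ := Nat.mul_pos (Nat.succ_pos _) hτ
    have hle : (k + 1) * τ ≤ L * τ := Nat.mul_le_mul_right _ hk
    let S : Finset (((_ : CARule n) × Fin n) × Fin n) :=
      (Ω.sigma fun f => Finset.univ.filter fun y => (k, y) ∈ Z f) ×ˢ Finset.univ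
    have hS : (S.card : ℝ) =
        n * ∑ f ∈ Ω, ((Finset.univ.filter fun y => (k, y) ∈ Z f).card : ℝ) := by
      simp only [S]
      rw [Finset.card_product, Finset.card_sigma, Finset.card_univ, Fintype.card_fin, mul_comm]
      push_cast
      rfl
    rw [← hS]
    have hsub : RG ⊆ S.image fun q => (updateRule q.1.1 (a ((k + 1) * τ - 1))
        (traj q.1.1 a q.1.2 ((k + 1) * τ - 1)) q.2, q.1.2) := by
      rintro ⟨f, y⟩ hp
      obtain ⟨-, hpin, habs, hfree⟩ := Finset.mem_filter.1 hp
      simp only at hpin habs hfree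
      obtain ⟨hcyc, htraj⟩ := avoidingCycle_updateRule hpos hle hfree
      have hback : updateRule (updateRule f (a ((k + 1) * τ - 1))
          (traj f a y ((k + 1) * τ - 1)) y) (a ((k + 1) * τ - 1))
          (traj (updateRule f (a ((k + 1) * τ - 1)) (traj f a y ((k + 1) * τ - 1)) y) a y
            ((k + 1) * τ - 1)) (f (a ((k + 1) * τ - 1)) (traj f a y ((k + 1) * τ - 1))) = f := by
        rw [htraj _ (by omega), updateRule_updateRule_self]
      rw [Finset.mem_image]
      refine ⟨⟨⟨updateRule f (a ((k + 1) * τ - 1)) (traj f a y ((k + 1) * τ - 1)) y, y⟩,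
        f (a ((k + 1) * τ - 1)) (traj f a y ((k + 1) * τ - 1))⟩, ?_, ?_⟩
      · simp only [S, Finset.mem_product, Finset.mem_sigma, Finset.mem_univ, and_true,
          Finset.mem_filter, true_and, Z, hΩ, Finset.mem_range]
        -- The pins survive because the redirected entry has its second coordinate outside `B`.
        refine ⟨?_, hk, hcyc, _, by rw [hback]; exact habs⟩
        intro e he
        rw [updateRule, if_neg]
        · exact hpin e he
        · rintro ⟨-, h2⟩
          exact hfree.2 ((k + 1) * τ - 1) (by omega) (h2 ▸ hEB e he)
      · simp only [hback]
    exact_mod_cast (Finset.card_le_card hsub).trans Finset.card_image_le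
  calc (RG.card : ℝ) * ∑ k ∈ Finset.range L, (1 : ℝ) / ((k : ℝ) + 1)
      ≤ ∑ k ∈ Finset.range L,
          (n * ∑ f ∈ Ω, ((Finset.univ.filter fun y => (k, y) ∈ Z f).card : ℝ)) *
            (1 / ((k : ℝ) + 1)) := by
        rw [Finset.mul_sum]
        refine Finset.sum_le_sum fun k hk => ?_
        have := hcard k hk
        gcongr
    _ = n * ∑ f ∈ Ω, ∑ k ∈ Finset.range L,
          ((Finset.univ.filter fun y => (k, y) ∈ Z f).card : ℝ) * (1 / ((k : ℝ) + 1)) := by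
        rw [Finset.sum_comm, Finset.mul_sum]
        refine Finset.sum_congr rfl fun k _ => ?_
        rw [mul_assoc, Finset.sum_mul]
    _ = n * ∑ f ∈ Ω, ∑ z ∈ Z f, (1 : ℝ) / ((z.1 : ℝ) + 1) := by
        congr 1
        refine Finset.sum_congr rfl fun f _ => ?_
        have h1 : Z f = (Finset.range L ×ˢ Finset.univ).filter fun z => z ∈ Z f := by
          ext z
          simp only [Finset.mem_filter, Z]
          tauto
        conv_rhs => rw [h1, Finset.sum_filter, Finset.sum_product]
        refine Finset.sum_congr rfl fun k _ => ?_
        simp only [← Finset.sum_filter, Finset.sum_const, nsmul_eq_mul]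
    _ ≤ n * ∑ f ∈ Ω, (τ : ℝ) := by
        gcongr with f _
        exact hZsum f
    _ = _ := by
        rw [Finset.sum_const, nsmul_eq_mul]
        ring
end

section
variable {n : ℕ}

/-- Trajectories that avoid the prescribed states are built from independent uniform values. -/
theorem le_sum_ruleProb_free (hn : 0 < n) (a : ℕ → Fin n) (m : ℕ) (E : Finset (Fin n × Fin n))
    (h : Fin n × Fin n → Fin n) (B : Finset (Fin n)) (hEB : ∀ e ∈ E, e.2 ∈ B) :
    ((n - B.card).descFactorial (m + 1) : ℝ) * ((n : ℝ)⁻¹) ^ (E.card + m) ≤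
      ∑ y, ruleProb n (pinnedRules E h ∩ freeRules a B m y) := by
  classical
  -- A free trajectory is a sequence of `m + 1` distinct states outside `B`. It uses `m` entries of
  -- the rule, distinct from each other and from `E`, and for a given rule it is determined by its
  -- first state.
  let I := Fin (m + 1) ↪ {x : Fin n // x ∉ B}
  let A : I → Set (CARule n) := fun s =>
    {f | f ∈ pinnedRules E h ∧
      ∀ t : Fin m, f (a t) (s t.castSucc) = s t.succ}
  have hA : ∀ s, ruleProb n (A s) = ((n : ℝ)⁻¹) ^ (E.card + m) := by
    intro s
    have hinj : Function.Injective (fun t : Fin m => (a t, (s t.castSucc : Fin n))) := by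
      intro t t' htt
      simp only [Prod.mk.injEq] at htt
      exact Fin.castSucc_injective _ (s.injective (Subtype.ext htt.2))
    have hdisj : Disjoint E (Finset.univ.image fun t : Fin m => (a t, (s t.castSucc : Fin n))) := by
      rw [Finset.disjoint_left]
      intro e he he'
      obtain ⟨t, -, rfl⟩ := Finset.mem_image.1 he'
      exact (s t.castSucc).2 (hEB _ he)
    have h1 := ruleProb_pinned hn
      (E ∪ Finset.univ.image fun t : Fin m => (a t, (s t.castSucc : Fin n)))
      (fun e => if e ∈ E then h e else
        Function.extend (fun t : Fin m => (a t, (s t.castSucc : Fin n)))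
          (fun t => (s t.succ : Fin n)) (fun _ => ⟨0, hn⟩) e)
    rw [Finset.card_union_of_disjoint hdisj, Finset.card_image_of_injective _ hinj,
      Finset.card_univ, Fintype.card_fin] at h1
    rw [← h1]
    congr 1
    ext f
    have hnot : ∀ t : Fin m, (a t, (s t.castSucc : Fin n)) ∉ E := fun t ht =>
      (s t.castSucc).2 (hEB _ ht)
    simp only [A, pinnedRules, Set.mem_ofPred_eq, Finset.mem_union, Finset.mem_image,
      Finset.mem_univ, true_and]
    constructor
    · rintro ⟨h2, h3⟩ e (he | ⟨t, rfl⟩)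
      · rw [if_pos he]
        exact h2 e he
      · rw [if_neg (hnot t), hinj.extend_apply]
        exact h3 t
    · intro h2
      refine ⟨fun e he => ?_, fun t => ?_⟩
      · have := h2 e (Or.inl he)
        rwa [if_pos he] at this
      · have := h2 _ (Or.inr ⟨t, rfl⟩)
        rwa [if_neg (hnot t), hinj.extend_apply] at this
  have htraj : ∀ (f : CARule n) (s : I), f ∈ A s → ∀ t : Fin (m + 1),
      traj f a (s 0) t = s t := by
    intro f s hf t
    induction t using Fin.induction with
    | zero => rfl
    | succ t ih =>
      rw [Fin.val_succ, traj, ← hf.2 t]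
      rw [Fin.val_castSucc] at ih
      rw [ih]
  have hpt : ∀ f : CARule n, 1 * (∑ s, if f ∈ A s then (1 : ℝ) else 0) ≤
      1 * ∑ y, if f ∈ pinnedRules E h ∩ freeRules a B m y then (1 : ℝ) else 0 := by
    intro f
    rw [one_mul, one_mul, Finset.sum_boole, Finset.sum_boole]
    norm_cast
    apply Finset.card_le_card_of_injOn (fun s => (s 0 : Fin n))
    · intro s hs
      have hs' : f ∈ A s := (Finset.mem_filter.1 (Finset.mem_coe.1 hs)).2
      have h1 := htraj f s hs'
      refine Finset.mem_coe.2 (Finset.mem_filter.2 ⟨Finset.mem_univ _, hs'.1, ?_, ?_⟩)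
      · intro t ht t' ht' htt
        have h2 := h1 ⟨t, Nat.lt_succ_of_le ht⟩
        have h3 := h1 ⟨t', Nat.lt_succ_of_le ht'⟩
        simp only at h2 h3 htt
        rw [h2, h3] at htt
        exact congrArg Fin.val (s.injective (Subtype.ext htt))
      · intro t ht
        have h2 := h1 ⟨t, Nat.lt_succ_of_le ht⟩
        simp only at h2 ⊢
        rw [h2]
        exact (s _).2
    · intro s hs s' hs' hss
      have hs2 : f ∈ A s := (Finset.mem_filter.1 (Finset.mem_coe.1 hs)).2
      have hs2' : f ∈ A s' := (Finset.mem_filter.1 (Finset.mem_coe.1 hs')).2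
      apply DFunLike.ext
      intro t
      apply Subtype.ext
      simp only at hss
      rw [← htraj f s hs2, ← htraj f s' hs2', hss]
  have hsum := ruleProb_sum_le_sum A _ 1 1 fun f => by convert hpt f
  simp_rw [one_mul, hA] at hsum
  refine le_trans (le_of_eq ?_) hsum
  rw [Finset.sum_const, Finset.card_univ, Fintype.card_embedding_eq, nsmul_eq_mul]
  congr 2
  rw [Fintype.card_subtype_compl, Fintype.card_fin, Fintype.card_fin, Fintype.card_coe]

/-- Given the pins, absorption either occurs together with a free trajectory, which the switching
bound controls by `τ` over the harmonic sum, or the trajectory of a start is not free. The estimate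
averages over the start. -/
theorem ruleProb_pinned_inter_absorbed_le (hn : 0 < n) {a : ℕ → Fin n} {τ : ℕ}
    (ha : ∀ t, a (t + τ) = a t) (hτ : 0 < τ) (L : ℕ) (hL : 0 < L) (E : Finset (Fin n × Fin n))
    (h : Fin n × Fin n → Fin n) (B : Finset (Fin n)) (hEB : ∀ e ∈ E, e.2 ∈ B) :
    ruleProb n (pinnedRules E h ∩ absorbedRules a B) ≤
      ((n : ℝ)⁻¹) ^ E.card * (τ / (∑ k ∈ Finset.range L, (1 : ℝ) / ((k : ℝ) + 1)) +
        (1 - ((n - B.card).descFactorial (L * τ + 1) : ℝ) * ((n : ℝ)⁻¹) ^ (L * τ + 1))) := by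
  classical
  have hn' : (0 : ℝ) < n := by exact_mod_cast hn
  set H := ∑ k ∈ Finset.range L, (1 : ℝ) / ((k : ℝ) + 1) with hH
  have hHpos : 0 < H := Finset.sum_pos (fun k _ => by positivity)
    (Finset.nonempty_range_iff.2 hL.ne')
  set m := L * τ
  set Ω := pinnedRules E h with hΩ
  have hΩp : ruleProb n Ω = ((n : ℝ)⁻¹) ^ E.card := ruleProb_pinned hn E h
  have h1 : (∑ y, ruleProb n (Ω ∩ absorbedRules a B ∩ freeRules a B m y)) * H ≤
      n * τ * ruleProb n Ω := by
    have h2 := card_absorbed_free_mul_le ha hτ L E h B hEB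
    have h3 : ∑ y, ruleProb n (Ω ∩ absorbedRules a B ∩ freeRules a B m y) =
        ((Finset.univ.filter fun p : CARule n × Fin n => p.1 ∈ Ω ∧
          p.1 ∈ absorbedRules a B ∧ p.1 ∈ freeRules a B m p.2).card : ℝ) /
            (n : ℝ) ^ (n ^ 2) := by
      simp_rw [ruleProb_eq_sum, ← Finset.sum_div]
      congr 1
      rw [← Finset.sum_boole, Fintype.sum_prod_type, Finset.sum_comm]
      simp only [Set.mem_inter_iff, and_assoc]
    rw [h3, ruleProb_eq_sum, Finset.sum_boole, div_mul_eq_mul_div, ← mul_div_assoc]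
    gcongr
  have h2 := le_sum_ruleProb_free hn a m E h B hEB
  have h3 : ∀ y, ruleProb n (Ω ∩ absorbedRules a B) + ruleProb n (Ω ∩ freeRules a B m y) ≤
      ruleProb n (Ω ∩ absorbedRules a B ∩ freeRules a B m y) + ruleProb n Ω := by
    intro y
    have := ruleProb_sum_le_sum
      (fun b : Bool => if b then Ω ∩ absorbedRules a B else Ω ∩ freeRules a B m y)
      (fun b : Bool => if b then Ω ∩ absorbedRules a B ∩ freeRules a B m y else Ω) 1 1 (fun f => by
        simp only [Fintype.sum_bool, if_true, Bool.false_eq_true, if_false, Set.mem_inter_iff]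
        by_cases h4 : f ∈ Ω <;> by_cases h5 : f ∈ absorbedRules a B <;>
          by_cases h6 : f ∈ freeRules a B m y <;> simp [h4, h5, h6])
    simpa using this
  have h4 := Finset.sum_le_sum fun y (_ : y ∈ Finset.univ) => h3 y
  rw [Finset.sum_add_distrib, Finset.sum_add_distrib, Finset.sum_const, Finset.sum_const,
    Finset.card_univ, Fintype.card_fin, nsmul_eq_mul, nsmul_eq_mul] at h4
  have h5 : (∑ y, ruleProb n (Ω ∩ absorbedRules a B ∩ freeRules a B m y)) ≤
      n * τ * ruleProb n Ω / H := by rwa [le_div_iff₀ hHpos]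
  rw [hΩp] at h4 h5
  have h6 : (n : ℝ) * ruleProb n (Ω ∩ absorbedRules a B) ≤
      n * τ * ((n : ℝ)⁻¹) ^ E.card / H + n * ((n : ℝ)⁻¹) ^ E.card -
        ((n - B.card).descFactorial (m + 1) : ℝ) * ((n : ℝ)⁻¹) ^ (E.card + m) := by linarith
  refine le_of_mul_le_mul_left (h6.trans (le_of_eq ?_)) hn'
  rw [pow_add, pow_succ]
  field_simp
  ring

/-- With boundedly many prescribed values, absorption by the prescribed states has vanishing
conditional probability. -/
theorem exists_absorbed_bound (τ K : ℕ) (hτ : 0 < τ) (ε : ℝ) (hε : 0 < ε) :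
    ∃ N : ℕ, ∀ n ≥ N, ∀ (a : ℕ → Fin n), (∀ t, a (t + τ) = a t) →
      ∀ (E : Finset (Fin n × Fin n)) (h : Fin n × Fin n → Fin n) (B : Finset (Fin n)),
        (∀ e ∈ E, e.2 ∈ B) → B.card ≤ K →
        ruleProb n (pinnedRules E h ∩ absorbedRules a B) ≤ ε * ((n : ℝ)⁻¹) ^ E.card := by
  -- The length `L` is fixed first so that the harmonic term is at most `ε / 2`; only then is `n`
  -- taken large enough for a trajectory of length `L * τ` to be free up to `ε / 2`.
  have h1 : ∀ᶠ L : ℕ in atTop,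
      2 * τ / ε < ∑ k ∈ Finset.range L, (1 : ℝ) / ((k : ℝ) + 1) :=
    Real.tendsto_sum_range_one_div_nat_succ_atTop.eventually_gt_atTop _
  obtain ⟨L, hL, hLpos⟩ := (h1.and (eventually_gt_atTop 0)).exists
  set H := ∑ k ∈ Finset.range L, (1 : ℝ) / ((k : ℝ) + 1) with hH
  have hHpos : 0 < H := Finset.sum_pos (fun k _ => by positivity)
    (Finset.nonempty_range_iff.2 hLpos.ne')
  set m := L * τ with hm
  have hlim : Tendsto (fun n : ℕ => ((m + 1 : ℕ) : ℝ) * ((K + m : ℕ) : ℝ) / (n : ℝ)) atTop (𝓝 0) :=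
    tendsto_const_div_atTop_nhds_zero_nat _
  have h2 : ∀ᶠ n : ℕ in atTop, ((m + 1 : ℕ) : ℝ) * ((K + m : ℕ) : ℝ) / (n : ℝ) < ε / 2 :=
    hlim.eventually_lt_const (by positivity)
  obtain ⟨N, hN⟩ := eventually_atTop.1 (h2.and (eventually_gt_atTop (K + m)))
  refine ⟨N, fun n hnN a ha E h B hEB hB => ?_⟩
  obtain ⟨h3, h4⟩ := hN n hnN
  have hn : 0 < n := by omega
  have hn' : (0 : ℝ) < n := by exact_mod_cast hn
  refine (ruleProb_pinned_inter_absorbed_le hn ha hτ L hLpos E h B hEB).trans ?_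
  rw [mul_comm]
  refine mul_le_mul_of_nonneg_right ?_ (by positivity)
  have h5 : (τ : ℝ) / H ≤ ε / 2 := by
    rw [div_le_iff₀ hHpos]
    rw [div_lt_iff₀ hε] at hL
    linarith
  have h6 : (1 : ℝ) - ((m + 1 : ℕ) : ℝ) * ((K + m : ℕ) : ℝ) / (n : ℝ) ≤
      ((n - B.card).descFactorial (m + 1) : ℝ) * ((n : ℝ)⁻¹) ^ (m + 1) := by
    have h7 : (n - (K + m)) ^ (m + 1) ≤ (n - B.card).descFactorial (m + 1) :=
      (Nat.pow_le_pow_left (by omega) _).trans (Nat.pow_sub_le_descFactorial _ _)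
    have h8 : (((n - (K + m)) ^ (m + 1) : ℕ) : ℝ) ≤ (n - B.card).descFactorial (m + 1) := by
      exact_mod_cast h7
    rw [Nat.cast_pow, Nat.cast_sub h4.le] at h8
    have h9 : -2 ≤ -(((K + m : ℕ) : ℝ) / n) := by
      have : ((K + m : ℕ) : ℝ) / n ≤ 1 := by
        rw [div_le_one hn']
        exact_mod_cast h4.le
      linarith
    -- Bernoulli's inequality for the chance of avoiding `K + m` forbidden states at all `m + 1`
    -- draws.
    have h10 := one_add_mul_le_pow h9 (m + 1)
    calc (1 : ℝ) - ((m + 1 : ℕ) : ℝ) * ((K + m : ℕ) : ℝ) / (n : ℝ)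
        = 1 + ((m + 1 : ℕ) : ℝ) * -(((K + m : ℕ) : ℝ) / n) := by ring
      _ ≤ (1 + -(((K + m : ℕ) : ℝ) / n)) ^ (m + 1) := h10
      _ = ((n : ℝ) - ((K + m : ℕ) : ℝ)) ^ (m + 1) * ((n : ℝ)⁻¹) ^ (m + 1) := by
        rw [← mul_pow]
        congr 1
        field_simp
        ring
      _ ≤ _ := by gcongr
  linarith
end

/-! ### Weak robustness is the collapse of every column onto its right neighbour -/

section
variable {n : ℕ}

theorem caEvolve_succ (f : CARule n) (ξ : CAConfig n) (t : ℕ) (x : ℤ) :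
    caEvolve f ξ (t + 1) x = f (caEvolve f ξ t (x - 1)) (caEvolve f ξ t x) := by
  unfold caEvolve
  rw [Function.iterate_succ_apply']
  rfl

theorem caEvolve_add (f : CARule n) (ξ : CAConfig n) (s t : ℕ) :
    caEvolve f ξ (s + t) = caEvolve f (caEvolve f ξ t) s :=
  Function.iterate_add_apply _ _ _ _

theorem drivenStep_iterate_fst {τ : ℕ} (f : CARule n) (a : ZMod τ → Fin n) (p : ZMod τ × Fin n)
    (k : ℕ) : ((drivenStep f (· + 1) a)^[k] p).1 = p.1 + k := by
  induction k with
  | zero => simp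
  | succ k ih =>
    rw [Function.iterate_succ_apply']
    simp only [drivenStep]
    rw [ih]
    push_cast
    ring

theorem drivenStep_iterate_snd {τ : ℕ} (f : CARule n) (a : ZMod τ → Fin n) (y : Fin n) (k : ℕ) :
    ((drivenStep f (· + 1) a)^[k] (0, y)).2 = traj f (fun t : ℕ => a t) y k := by
  induction k with
  | zero => rfl
  | succ k ih =>
    rw [Function.iterate_succ_apply', traj]
    simp only [drivenStep]
    rw [ih, drivenStep_iterate_fst]
    simp

theorem collapses_shift {τ : ℕ} {f : CARule n} {a c : ZMod τ → Fin n}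
    (h : Collapses f (· + 1) a c) (s : ZMod τ) :
    Collapses f (· + 1) (fun i => a (i + s)) (fun i => c (i + s)) := by
  rintro ⟨i, y⟩
  have key : ∀ k : ℕ, (drivenStep f (· + 1) a)^[k] (i + s, y) =
      (((drivenStep f (· + 1) fun i => a (i + s))^[k] (i, y)).1 + s,
        ((drivenStep f (· + 1) fun i => a (i + s))^[k] (i, y)).2) := by
    intro k
    induction k with
    | zero => rfl
    | succ k ih =>
      rw [Function.iterate_succ_apply', ih, Function.iterate_succ_apply']
      simp only [drivenStep, Prod.mk.injEq, and_true]
      ring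
  obtain ⟨k, hk⟩ := h (i + s, y)
  rw [key] at hk
  exact ⟨k, hk⟩

/-- Once the driven dynamics is on the graph of `c`, it stays there. -/
theorem drivenStep_iterate_mem_of_le {ι : Type*} {f : CARule n} {D : ι → ι} {a c : ι → Fin n}
    (hpin : ∀ i, f (a i) (c i) = c (D i)) {p : ι × Fin n} {k l : ℕ} (hkl : k ≤ l)
    (hk : ((drivenStep f D a)^[k] p).2 = c ((drivenStep f D a)^[k] p).1) :
    ((drivenStep f D a)^[l] p).2 = c ((drivenStep f D a)^[l] p).1 := by
  induction l, hkl using Nat.le_induction with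
  | base => exact hk
  | succ l _ ih =>
    rw [Function.iterate_succ_apply']
    simp only [drivenStep]
    rw [ih, hpin]

/-- `U` is the space-time configuration of `ξ` under the rule `f`. -/
def IsSpaceTime {τ σ : ℕ} (f : CARule n) (ξ : CAConfig n) (U : ZMod τ → ZMod σ → Fin n) : Prop :=
  ∀ (t : ℕ) (x : ℤ), caEvolve f ξ t x = U t x

/-- The doubly periodic array `U` satisfies the local rule `f`. -/
def Satisfies {τ σ : ℕ} (f : CARule n) (U : ZMod τ → ZMod σ → Fin n) : Prop :=
  ∀ t x, f (U t x) (U t (x + 1)) = U (t + 1) (x + 1)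

variable {τ σ : ℕ} {f : CARule n} {ξ : CAConfig n}

theorem caEvolve_spatial_periodic (h : ∀ x : ℤ, ξ (x + σ) = ξ x) (t : ℕ) (x : ℤ) :
    caEvolve f ξ t (x + σ) = caEvolve f ξ t x := by
  induction t generalizing x with
  | zero => exact h x
  | succ t ih => rw [caEvolve_succ, caEvolve_succ, add_sub_right_comm, ih, ih]

theorem IsPS.exists_isSpaceTime [NeZero τ] [NeZero σ] (h : IsPS f τ σ ξ) :
    ∃ U : ZMod τ → ZMod σ → Fin n, IsSpaceTime f ξ U := by
  refine ⟨fun t x => caEvolve f ξ t.val x.val, fun t x => ?_⟩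
  have h1 : Function.Periodic (fun t => caEvolve f ξ t) τ := fun t => by
    simp only
    rw [caEvolve_add, h.temporal.1.2]
  have h2 : Function.Periodic (caEvolve f ξ (t % τ)) (σ : ℤ) :=
    caEvolve_spatial_periodic h.spatial.1.2 _
  simp only [ZMod.val_natCast, ZMod.val_intCast]
  rw [← h1.map_mod_nat t, ← Int.emod_add_mul_ediv x σ]
  rw [mul_comm, Int.add_mul_emod_self_right, Int.emod_emod, ← smul_eq_mul, h2.zsmul]

namespace IsSpaceTime
variable {U : ZMod τ → ZMod σ → Fin n}

theorem satisfies [NeZero τ] [NeZero σ] (h : IsSpaceTime f ξ U) : Satisfies f U := by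
  intro t x
  have h1 := caEvolve_succ f ξ t.val ((x.val : ℤ) + 1)
  rw [add_sub_cancel_right, h, h, h] at h1
  simpa using h1.symm

/-- Information moves only to the right, so agreement on a left half-line persists, and the first
site beyond it is driven by the true column. -/
theorem driven {η : CAConfig n} (h : IsSpaceTime f ξ U) {t : ℕ} {y : ℤ}
    (hag : ∀ z ≤ y, caEvolve f η t z = caEvolve f ξ t z) (s : ℕ) :
    (∀ z ≤ y, caEvolve f η (t + s) z = caEvolve f ξ (t + s) z) ∧
      caEvolve f η (t + s) (y + 1) = ((drivenStep f (· + 1) fun i : ZMod τ => U i y)^[s]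
        ((t : ZMod τ), caEvolve f η t (y + 1))).2 := by
  induction s with
  | zero => exact ⟨hag, rfl⟩
  | succ s ih =>
    constructor
    · intro z hz
      rw [← add_assoc, caEvolve_succ, caEvolve_succ, ih.1 z hz, ih.1 (z - 1) (by omega)]
    · rw [← add_assoc, caEvolve_succ, ih.2, add_sub_cancel_right, ih.1 y le_rfl, h,
        Function.iterate_succ_apply']
      simp only [drivenStep]
      rw [drivenStep_iterate_fst]
      simp

theorem eq_zero_of_row_eq [NeZero τ] (h : IsSpaceTime f ξ U) (hPS : IsPS f τ σ ξ) (t : ZMod τ)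
    (ht : ∀ x, U t x = U 0 x) : t = 0 := by
  by_contra hne
  have h1 : 0 < t.val := Nat.pos_of_ne_zero fun h0 => hne ((ZMod.val_eq_zero t).1 h0)
  have h2 := hPS.temporal.2 (show t.val ∈ {t : ℕ | 0 < t ∧ caEvolve f ξ t = ξ} from ⟨h1, by
    funext x
    have h3 := h 0 x
    rw [h, ZMod.natCast_zmod_val, ht]
    rw [Nat.cast_zero] at h3
    exact h3.symm⟩)
  exact absurd (ZMod.val_lt t) (not_lt.2 h2)

theorem eq_zero_of_translate_eq [NeZero σ] (h : IsSpaceTime f ξ U) (hPS : IsPS f τ σ ξ)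
    (x : ZMod σ) (hx : ∀ y, U 0 (y + x) = U 0 y) : x = 0 := by
  by_contra hne
  have h1 : 0 < x.val := Nat.pos_of_ne_zero fun h0 => hne ((ZMod.val_eq_zero x).1 h0)
  have h2 := hPS.spatial.2 (show x.val ∈ {s : ℕ | 0 < s ∧ ∀ x : ℤ, ξ (x + s) = ξ x} from ⟨h1, by
    intro y
    have h3 := h 0 y
    have h4 := h 0 (y + x.val)
    have h5 := hx y
    simp only [Nat.cast_zero, Int.cast_add, Int.cast_natCast, ZMod.natCast_zmod_val] at h3 h4
    rw [h5, ← h3] at h4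
    exact h4⟩)
  exact absurd (ZMod.val_lt x) (not_lt.2 h2)

end IsSpaceTime

theorem velocityIn_le_zero {η : CAConfig n} (j : ℤ)
    (h : ∀ t, caEvolve f η t (j + 1) ≠ caEvolve f ξ t (j + 1)) : velocityIn f ξ η ≤ 0 := by
  have h1 : ∀ t : ℕ, caFront f ξ η t / ((t : ℝ) : EReal) ≤ (((j : ℝ) / (t : ℝ) : ℝ) : EReal) := by
    intro t
    rw [EReal.coe_div]
    refine EReal.div_le_div_right_of_nonneg (by exact_mod_cast Nat.cast_nonneg t) ?_
    apply sSup_le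
    rintro s ⟨x, rfl, hx⟩
    have : x ≤ j := by
      by_contra! hlt
      exact h t (hx (j + 1) hlt)
    exact_mod_cast this
  have h2 : Tendsto (fun t : ℕ => (((j : ℝ) / (t : ℝ) : ℝ) : EReal)) atTop (𝓝 ((0 : ℝ) : EReal)) :=
    (continuous_coe_real_ereal.tendsto 0).comp (tendsto_const_div_atTop_nhds_zero_nat _)
  have h3 := h2.liminf_eq
  rw [EReal.coe_zero] at h3
  rw [← h3]
  exact liminf_le_liminf (Eventually.of_forall h1)

/-- A driven state that never reaches its target column gives a proper environment whose front is
stuck: put that state to the right of the driving column. -/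
theorem IsWRPS.collapses [NeZero τ] [NeZero σ] {U : ZMod τ → ZMod σ → Fin n}
    (h : IsWRPS f τ σ ξ) (hU : IsSpaceTime f ξ U) (x : ZMod σ) :
    Collapses f (· + 1) (fun t => U t x) (fun t => U t (x + 1)) := by
  rintro ⟨i, y⟩
  by_contra! hne
  set F := drivenStep f (· + 1) (fun t : ZMod τ => U t x) with hF
  -- The environment starts at time `0`, so the bad orbit is first run until its phase is `0`.
  obtain ⟨b, hb⟩ : ∃ b, F^[τ - i.val] (i, y) = (0, b) := by
    refine ⟨(F^[τ - i.val] (i, y)).2, Prod.ext ?_ rfl⟩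
    rw [drivenStep_iterate_fst, Nat.cast_sub (ZMod.val_lt i).le]
    simp
  let j : ℤ := x.val
  let η : CAConfig n := fun z => if z ≤ j then ξ z else b
  have hag : ∀ z ≤ j, caEvolve f η 0 z = caEvolve f ξ 0 z := fun z hz => if_pos hz
  have hjx : ((j : ℤ) : ZMod σ) = x := by simp [j]
  have hsep : ∀ t, caEvolve f η t (j + 1) ≠ caEvolve f ξ t (j + 1) := by
    intro t heq
    have h1 := (hU.driven hag t).2
    have h2 : caEvolve f η 0 (j + 1) = b := if_neg (by omega)
    rw [zero_add, heq, hU, h2, hjx] at h1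
    simp only [Nat.cast_zero] at h1
    rw [← hb, ← hF, ← Function.iterate_add_apply] at h1
    apply hne (t + (τ - i.val))
    rw [← h1, Function.iterate_add_apply, hb, drivenStep_iterate_fst]
    simp [hjx]
  have h1 : expansionVelocity f ξ ≤ velocityIn f ξ η :=
    sInf_le ⟨η, ⟨j, fun z hz => if_pos hz⟩, rfl⟩
  exact absurd h.weaklyRobust (not_lt.2 (h1.trans (velocityIn_le_zero j hsep)))

theorem le_velocityIn {η : CAConfig n} (y : ℤ) (M : ℕ) (hM : 0 < M)
    (h : ∀ t : ℕ, ∀ z ≤ y + (t / M : ℕ), caEvolve f η t z = caEvolve f ξ t z) :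
    (((1 : ℝ) / M : ℝ) : EReal) ≤ velocityIn f ξ η := by
  have hM' : (0 : ℝ) < M := by exact_mod_cast hM
  -- The `- 1` absorbs the rounding in `t / M` and disappears in the limit.
  have h1 : ∀ t : ℕ, 0 < t →
      ((((y : ℝ) - 1) / (t : ℝ) + 1 / M : ℝ) : EReal) ≤ caFront f ξ η t / ((t : ℝ) : EReal) := by
    intro t ht
    have ht' : (0 : ℝ) < t := by exact_mod_cast ht
    have h2 : ((((y + (t / M : ℕ) : ℤ) : ℝ)) : EReal) ≤ caFront f ξ η t := le_sSup ⟨_, rfl, h t⟩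
    have h3 : ((y : ℝ) - 1) / (t : ℝ) + 1 / M ≤ ((y + (t / M : ℕ) : ℤ) : ℝ) / t := by
      have h4 : (t : ℝ) / M < ((t / M : ℕ) : ℝ) + 1 := by
        rw [div_lt_iff₀ hM']
        have := Nat.lt_div_mul_add hM (a := t)
        have h5 : t < (t / M + 1) * M := by linarith
        exact_mod_cast h5
      have h6 : ((y : ℝ) - 1) / (t : ℝ) + 1 / M = (y - 1 + t / M) / t := by
        field_simp
      rw [h6]
      rw [Int.cast_add, Int.cast_natCast]
      refine div_le_div_of_nonneg_right ?_ ht'.le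
      linarith
    calc ((((y : ℝ) - 1) / (t : ℝ) + 1 / M : ℝ) : EReal)
        ≤ ((((y + (t / M : ℕ) : ℤ) : ℝ) / t : ℝ) : EReal) := by exact_mod_cast h3
      _ = ((((y + (t / M : ℕ) : ℤ) : ℝ)) : EReal) / ((t : ℝ) : EReal) := EReal.coe_div _ _
      _ ≤ _ := EReal.div_le_div_right_of_nonneg (by exact_mod_cast ht'.le) h2
  have h2 : Tendsto (fun t : ℕ => ((((y : ℝ) - 1) / (t : ℝ) + 1 / M : ℝ) : EReal)) atTop
      (𝓝 (((1 : ℝ) / M : ℝ) : EReal)) := by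
    refine (continuous_coe_real_ereal.tendsto _).comp ?_
    have := (tendsto_const_div_atTop_nhds_zero_nat ((y : ℝ) - 1)).add_const ((1 : ℝ) / M)
    rwa [zero_add] at this
  rw [← h2.liminf_eq]
  refine liminf_le_liminf ?_
  filter_upwards [eventually_gt_atTop 0] with t ht using h1 t ht

/-- There are finitely many columns, phases and states, so one time `M` suffices for every collapse.
Agreement then gains a site every `M` steps, and the velocity is at least `1 / M` in every proper
environment. -/
theorem IsPS.isWRPS [NeZero τ] [NeZero σ] {U : ZMod τ → ZMod σ → Fin n}
    (h : IsPS f τ σ ξ) (hU : IsSpaceTime f ξ U)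
    (hc : ∀ x, Collapses f (· + 1) (fun t => U t x) (fun t => U t (x + 1))) :
    IsWRPS f τ σ ξ := by
  refine ⟨h, ?_⟩
  choose k hk using hc
  let M : ℕ := (∑ q : ZMod σ × ZMod τ × Fin n, k q.1 q.2) + 1
  have hkM : ∀ x p, k x p ≤ M := fun x p =>
    (Finset.single_le_sum (f := fun q : ZMod σ × ZMod τ × Fin n => k q.1 q.2)
      (fun _ _ => Nat.zero_le _) (Finset.mem_univ (x, p))).trans (Nat.le_succ _)
  have hstep : ∀ (η : CAConfig n) (t : ℕ) (y : ℤ),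
      (∀ z ≤ y, caEvolve f η t z = caEvolve f ξ t z) →
      ∀ z ≤ y + 1, caEvolve f η (t + M) z = caEvolve f ξ (t + M) z := by
    intro η t y hag z hz
    obtain ⟨h1, h2⟩ := hU.driven hag M
    rcases (show z ≤ y ∨ z = y + 1 by omega) with hz | rfl
    · exact h1 z hz
    · rw [h2, drivenStep_iterate_mem_of_le (c := fun t : ZMod τ => U t (y + 1))
        (fun t => hU.satisfies t _) (hkM y _) (hk y _), drivenStep_iterate_fst, hU]
      simp
  have hM : 0 < M := Nat.succ_pos _
  have hv : (((1 : ℝ) / M : ℝ) : EReal) ≤ expansionVelocity f ξ := by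
    apply le_sInf
    rintro v ⟨η, ⟨y, hy⟩, rfl⟩
    apply le_velocityIn y M hM
    have h1 : ∀ q : ℕ, ∀ z ≤ y + q, caEvolve f η (q * M) z = caEvolve f ξ (q * M) z := by
      intro q
      induction q with
      | zero =>
        intro z hz
        rw [zero_mul]
        exact hy z (by simpa using hz)
      | succ q ih =>
        intro z hz
        rw [Nat.succ_mul]
        exact hstep η _ (y + q) ih z (by push_cast at hz; omega)
    intro t z hz
    have h2 := (hU.driven (h1 (t / M)) (t % M)).1 z hz
    rwa [Nat.div_add_mod'] at h2
  refine lt_of_lt_of_le ?_ hv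
  have : (0 : ℝ) < 1 / M := by positivity
  exact_mod_cast this
end

/-! ### Arrays, simplicity and cyclic words -/

/-- If the pairs `(u p, v p)` are no more numerous than the states `u p`, then `u` determines
`v`. -/
theorem eq_of_ncard_pairs_le {κ α β : Type*} [Finite κ] {u : κ → α} {v : κ → β}
    (h : (Set.range fun p => (u p, v p)).ncard ≤ (Set.range u).ncard) {p q : κ}
    (hpq : u p = u q) : v p = v q := by
  have h1 : Prod.fst '' (Set.range fun p => (u p, v p)) = Set.range u := by
    rw [← Set.range_comp]
    rfl
  have h2 : Set.InjOn Prod.fst (Set.range fun p => (u p, v p)) := by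
    rw [← Set.ncard_image_iff (Set.finite_range _), h1]
    refine le_antisymm ?_ h
    rw [← h1]
    exact Set.ncard_image_le (Set.finite_range _)
  exact congrArg Prod.snd (h2 ⟨p, rfl⟩ ⟨q, rfl⟩ hpq)

/-- Collapsing has vanishing conditional probability given boundedly many values of the rule. -/
theorem exists_collapses_bound (τ K : ℕ) [NeZero τ] (ε : ℝ) (hε : 0 < ε) :
    ∃ N : ℕ, ∀ n ≥ N, ∀ (a c : ZMod τ → Fin n) (P : Set (Fin n × Fin n)) (B : Set (Fin n)),
      (∀ e ∈ P, e.2 ∈ B) → B.ncard ≤ K → (∀ i, c i ∈ B) →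
      ∀ F : Set (CARule n), (∀ f ∈ F, ∀ g ∈ F, ∀ e ∈ P, f e.1 e.2 = g e.1 e.2) →
        (∀ f ∈ F, Collapses f (· + 1) a c) → ruleProb n F ≤ ε * ((n : ℝ)⁻¹) ^ P.ncard := by
  classical
  obtain ⟨N, hN⟩ := exists_absorbed_bound τ K (NeZero.pos τ) ε hε
  refine ⟨N, fun n hn a c P B hPB hB hc F hF hFc => ?_⟩
  -- The rules in `F` agree on `P`, so any member `g` supplies the pinned values. Reaching the graph
  -- of `c` means entering `B`, so collapse implies absorption.
  rcases F.eq_empty_or_nonempty with rfl | ⟨g, hg⟩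
  · rw [ruleProb_empty]
    positivity
  have h1 := hN n hn (fun t => a t) (fun t => by simp) P.toFinset (fun e => g e.1 e.2) B.toFinset
    (fun e he => by simpa using hPB e (by simpa using he))
    (by rwa [← Set.ncard_eq_toFinset_card'])
  rw [← Set.ncard_eq_toFinset_card'] at h1
  refine (ruleProb_mono ?_).trans h1
  intro f hf
  refine ⟨fun e he => hF f hf g hg e (by simpa using he), fun y => ?_⟩
  obtain ⟨k, hk⟩ := hFc f hf (0, y)
  refine ⟨k, ?_⟩
  rw [drivenStep_iterate_snd] at hk
  rw [hk]
  simpa using hc _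

section
variable {n τ σ : ℕ}

/-- The set of states of the array `U`. -/
def stateSet (U : ZMod τ → ZMod σ → Fin n) : Set (Fin n) :=
  Set.range fun p : ZMod τ × ZMod σ => U p.1 p.2

/-- The set of horizontally adjacent pairs of the array `U`. -/
def pairSet (U : ZMod τ → ZMod σ → Fin n) : Set (Fin n × Fin n) :=
  Set.range fun p : ZMod τ × ZMod σ => (U p.1 p.2, U p.1 (p.2 + 1))

/-- All columns of the array `U` collapse onto their right neighbours. -/
def CollapsesAll (f : CARule n) (U : ZMod τ → ZMod σ → Fin n) : Prop :=
  ∀ x, Collapses f (· + 1) (fun t => U t x) (fun t => U t (x + 1))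

/-- Equality of entries of the array `U` is invariant under translations. -/
theorem translate_eq_of_simple [NeZero τ] [NeZero σ] {f : CARule n} {U : ZMod τ → ZMod σ → Fin n}
    (hU : Satisfies f U) (hs : (pairSet U).ncard ≤ (stateSet U).ncard) {t t' : ZMod τ}
    {x x' : ZMod σ} (h : U t x = U t' x') (s : ZMod τ) (z : ZMod σ) :
    U (t + s) (x + z) = U (t' + s) (x' + z) := by
  have hright : ∀ {t t' : ZMod τ} {x x' : ZMod σ}, U t x = U t' x' →
      U t (x + 1) = U t' (x' + 1) := fun {t t' x x'} h =>
    eq_of_ncard_pairs_le (u := fun p : ZMod τ × ZMod σ => U p.1 p.2)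
      (v := fun p : ZMod τ × ZMod σ => U p.1 (p.2 + 1)) hs (p := (t, x)) (q := (t', x')) h
  have hrights : ∀ (k : ℕ) {t t' : ZMod τ} {x x' : ZMod σ}, U t x = U t' x' →
      U t (x + k) = U t' (x' + k) := by
    intro k t t' x x' h
    induction k with
    | zero => simpa using h
    | succ k ih =>
      have := hright ih
      push_cast
      rwa [← add_assoc, ← add_assoc]
  have hrights' : ∀ (z : ZMod σ) {t t' : ZMod τ} {x x' : ZMod σ}, U t x = U t' x' →
      U t (x + z) = U t' (x' + z) := by
    intro z t t' x x' h
    have := hrights z.val h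
    rwa [ZMod.natCast_zmod_val] at this
  have hdown : ∀ {t t' : ZMod τ} {x x' : ZMod σ}, U t x = U t' x' →
      U (t + 1) x = U (t' + 1) x' := by
    intro t t' x x' h
    have h1 := hrights' (-1) h
    have h2 := hU t (x + -1)
    have h3 := hU t' (x' + -1)
    rw [neg_add_cancel_right] at h2 h3
    rw [← h2, ← h3, h1, h]
  have hdowns : ∀ k : ℕ, U (t + k) x = U (t' + k) x' := by
    intro k
    induction k with
    | zero => simpa using h
    | succ k ih =>
      have := hdown ih
      push_cast
      rwa [← add_assoc, ← add_assoc]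
  have h1 := hdowns s.val
  rw [ZMod.natCast_zmod_val] at h1
  exact hrights' z h1

/-- A simple array with a state outside of column `0` is rarely weakly robust. -/
theorem ruleProb_simple_le [NeZero τ] [NeZero σ] (hn : 0 < n) (U : ZMod τ → ZMod σ → Fin n)
    (hs : (pairSet U).ncard ≤ (stateSet U).ncard) (hm : ∀ m, U 0 1 ≠ U m 0) :
    ruleProb n {f | Satisfies f U ∧ CollapsesAll f U} ≤
      ((stateSet U).ncard : ℝ) ^ 2 * ((n : ℝ)⁻¹) ^ ((stateSet U).ncard + 2) := by
  classical
  rcases Set.eq_empty_or_nonempty {f | Satisfies f U ∧ CollapsesAll f U} with hE | ⟨g, hg, -⟩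
  · rw [hE, ruleProb_empty]
    positivity
  have hinv := fun {t t' : ZMod τ} {x x' : ZMod σ} => translate_eq_of_simple hg hs (t := t)
    (t' := t') (x := x) (x' := x')
  -- The drivers are states and not positions, which makes the driver map injective. Translation
  -- invariance makes the time step `D` and the right neighbour `c` independent of the chosen
  -- positions `e`.
  let r : ZMod τ × ZMod σ → stateSet U := fun p => ⟨U p.1 p.2, ⟨p, rfl⟩⟩
  have hr : Function.Surjective r := by
    rintro ⟨_, ⟨p, rfl⟩⟩
    exact ⟨p, rfl⟩
  let e := Function.surjInv hr
  have he : ∀ s, U (e s).1 (e s).2 = s.1 := fun s => congrArg Subtype.val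
    (Function.surjInv_eq hr s)
  let D : stateSet U → stateSet U := fun s => r ((e s).1 + 1, (e s).2)
  let c : stateSet U → Fin n := fun s => U (e s).1 ((e s).2 + 1)
  have hD : ∀ t x, D (r (t, x)) = r (t + 1, x) := by
    intro t x
    have := hinv (he (r (t, x))) 1 0
    simp only [add_zero] at this
    exact Subtype.ext this
  have hc : ∀ t x, c (r (t, x)) = U t (x + 1) := by
    intro t x
    have := hinv (he (r (t, x))) 0 1
    simp only [add_zero] at this
    exact this
  have hDk : ∀ (k : ℕ) t x, D^[k] (r (t, x)) = r (t + k, x) := by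
    intro k t x
    induction k with
    | zero => simp
    | succ k ih =>
      rw [Function.iterate_succ_apply', ih, hD]
      push_cast
      rw [add_assoc]
  -- If the orbits of `U 0 0` and `U 0 1` met, a translation in time would put `U 0 1` into column
  -- `0`.
  have h1 := ruleProb_pinned_collapses_le hn D (fun s => s.1) c Subtype.val_injective
    (r (0, 0)) (r (0, 1)) (fun k l hkl => by
      rw [hDk, hDk] at hkl
      have h2 : U (0 + k) 0 = U (0 + l) 1 := congrArg Subtype.val hkl
      have h3 := hinv h2 (-l) 0
      apply hm (0 + k + -l)
      simp only [add_zero, zero_add, add_neg_cancel] at h3 ⊢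
      exact h3.symm)
  have hcard : Fintype.card (stateSet U) = (stateSet U).ncard := by
    rw [Set.ncard_eq_toFinset_card', Set.toFinset_card]
  rw [hcard] at h1
  refine (ruleProb_mono ?_).trans h1
  rintro f ⟨hf, hfc⟩
  constructor
  · intro s
    obtain ⟨⟨t, x⟩, rfl⟩ := hr s
    rw [hD, hc, hc]
    exact hf t x
  · rintro ⟨s, y⟩
    obtain ⟨⟨t, x⟩, rfl⟩ := hr s
    obtain ⟨k, hk⟩ := hfc x (t, y)
    have key : ∀ k : ℕ, (drivenStep f D fun s => s.1)^[k] (r (t, x), y) =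
        (r (((drivenStep f (· + 1) fun t => U t x)^[k] (t, y)).1, x),
          ((drivenStep f (· + 1) fun t => U t x)^[k] (t, y)).2) := by
      intro k
      induction k with
      | zero => rfl
      | succ k ih =>
        rw [Function.iterate_succ_apply', ih, Function.iterate_succ_apply']
        simp only [drivenStep]
        rw [hD]
    refine ⟨k, ?_⟩
    rw [key]
    simp only
    rw [hc]
    exact hk

/-- A cyclic word of distinct states that yields a weakly robust periodic solution moving `m`
steps per site. -/
structure IsGood (f : CARule n) (σ : ℕ) (p : (ZMod τ → Fin n) × ZMod τ) : Prop where
  inj : Function.Injective p.1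
  order : addOrderOf p.2 = σ
  pin : ∀ i, f (p.1 i) (p.1 (i + p.2)) = p.1 (i + p.2 + 1)
  collapse : Collapses f (· + 1) p.1 (fun i => p.1 (i + p.2))

/-- The configuration `x ↦ a (x m)` evolves to `a (t + x m)`. Injectivity of `a` makes the periods
exactly `τ` and the order of `m`, and every column is a shift of the word, so one collapse implies
all of them. -/
theorem IsGood.wrpsSet_nonempty [NeZero τ] [NeZero σ] {f : CARule n}
    {p : (ZMod τ → Fin n) × ZMod τ} (h : IsGood f σ p) : (wrpsSet f τ σ).Nonempty := by
  obtain ⟨a, m⟩ := p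
  obtain ⟨hinj, hord, hpin, hcol⟩ := h
  simp only at hinj hord hpin hcol
  let ξ : CAConfig n := fun x => a (x * m)
  have hev : ∀ (t : ℕ) (x : ℤ), caEvolve f ξ t x = a (t + x * m) := by
    intro t
    induction t with
    | zero => intro x; simp [caEvolve, ξ]
    | succ t ih =>
      intro x
      rw [caEvolve_succ, ih, ih]
      have h1 := hpin (t + (x - 1 : ℤ) * m)
      push_cast at h1 ⊢
      have h2 : (t : ZMod τ) + ((x : ZMod τ) - 1) * m + m = t + x * m := by ring
      rw [h2] at h1
      rw [h1]
      ring_nf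
  have hσm : (σ : ZMod τ) * m = 0 := by
    rw [← nsmul_eq_mul, ← hord, addOrderOf_nsmul_eq_zero]
  have hPS : IsPS f τ σ ξ := by
    refine ⟨⟨⟨NeZero.pos σ, fun x => ?_⟩, ?_⟩, ⟨⟨NeZero.pos τ, ?_⟩, ?_⟩⟩
    · simp only [ξ]
      push_cast
      rw [add_mul, hσm, add_zero]
    · rintro s ⟨hs, hs'⟩
      have h1 := hinj (hs' 0)
      push_cast at h1
      rw [zero_add, zero_mul, ← nsmul_eq_mul] at h1
      rw [← hord]
      exact Nat.le_of_dvd hs (addOrderOf_dvd_of_nsmul_eq_zero h1)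
    · funext x
      rw [hev]
      simp [ξ]
    · rintro t ⟨ht, ht'⟩
      have h1 := congrFun ht' 0
      rw [hev] at h1
      have h2 := hinj h1
      simp only [Int.cast_zero, zero_mul, add_zero] at h2
      exact Nat.le_of_dvd ht ((ZMod.natCast_eq_zero_iff t τ).1 h2)
  let U : ZMod τ → ZMod σ → Fin n := fun t x => a (t + x.val * m)
  have hval : ∀ x : ℤ, (((x : ZMod σ).val : ℕ) : ZMod τ) * m = x * m := by
    intro x
    have h1 : ((((x : ZMod σ).val : ℕ) : ℤ) : ZMod τ) = ((x % σ : ℤ) : ZMod τ) := by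
      rw [ZMod.val_intCast]
    rw [Int.cast_natCast] at h1
    rw [h1]
    conv_rhs => rw [← Int.emod_add_mul_ediv x σ]
    push_cast
    linear_combination (-(x / (σ : ℤ) : ℤ) : ZMod τ) * hσm
  have hU : IsSpaceTime f ξ U := by
    intro t x
    simp only [U]
    rw [hev, hval]
  refine ⟨ξ, hPS.isWRPS hU fun x => ?_⟩
  have h1 := collapses_shift hcol (x.val * m)
  have h2 : ∀ t, U t (x + 1) = a (t + x.val * m + m) := by
    intro t
    simp only [U]
    have h3 := hval ((x.val : ℤ) + 1)
    push_cast at h3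
    rw [ZMod.natCast_zmod_val] at h3
    rw [h3]
    congr 1
    ring
  simp_rw [h2]
  exact h1

/-- A simple weakly robust array whose column `0` contains a state of column `1` comes from a good
cyclic word. -/
theorem exists_isGood_of_simple [NeZero τ] [NeZero σ] {f : CARule n} {ξ : CAConfig n}
    {U : ZMod τ → ZMod σ → Fin n} (h : IsPS f τ σ ξ) (hU : IsSpaceTime f ξ U)
    (hc : CollapsesAll f U) (hs : (pairSet U).ncard ≤ (stateSet U).ncard) {m : ZMod τ}
    (hm : U 0 1 = U m 0) : IsGood f σ (fun i => U i 0, m) := by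
  have hsat := hU.satisfies
  have hinv := fun {t t' : ZMod τ} {x x' : ZMod σ} => translate_eq_of_simple hsat hs (t := t)
    (t' := t') (x := x) (x' := x')
  -- A repeated state in column `0` would, by translation invariance, repeat a whole row and
  -- contradict the minimality of `τ`.
  have hinj : Function.Injective fun i => U i 0 := by
    intro i j hij
    have h1 := hU.eq_zero_of_row_eq h (i - j) fun x => by
      have := hinv hij (-j) x
      simpa [sub_eq_add_neg] using this
    exact sub_eq_zero.1 h1
  have h1 : ∀ t, U t 1 = U (t + m) 0 := by
    intro t
    have := hinv hm t 0
    simpa [add_comm] using this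
  have hk : ∀ k : ℕ, U 0 k = U (k • m) 0 := by
    intro k
    induction k with
    | zero => simp
    | succ k ih =>
      have h2 := hinv ih 0 1
      simp only [add_zero, zero_add] at h2
      push_cast
      rw [h2, h1, succ_nsmul]
  refine ⟨hinj, ?_, fun i => ?_, ?_⟩
  · have h2 : ∀ k : ℕ, k • m = 0 ↔ σ ∣ k := by
      intro k
      rw [← ZMod.natCast_eq_zero_iff]
      constructor
      · intro hkm
        refine hU.eq_zero_of_translate_eq h _ fun y => ?_
        have h3 := hk k
        rw [hkm] at h3
        have := hinv h3 0 y
        simpa [add_comm] using this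
      · intro hk0
        have h3 := hk k
        rw [hk0] at h3
        exact hinj h3.symm
    apply Nat.dvd_antisymm
    · exact addOrderOf_dvd_of_nsmul_eq_zero ((h2 σ).2 dvd_rfl)
    · exact (h2 _).1 (addOrderOf_nsmul_eq_zero m)
  · simp only
    have h2 := hsat i 0
    rw [zero_add, h1, h1] at h2
    rw [h2]
    ring_nf
  · have h2 := hc 0
    simp only [zero_add, h1] at h2
    exact h2
end

/-! ### Union bounds for the negligible arrays -/

section
variable {n τ σ : ℕ}

theorem lag_caTile [NeZero τ] [NeZero σ] {f : CARule n} {ξ : CAConfig n}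
    {U : ZMod τ → ZMod σ → Fin n} (hU : IsSpaceTime f ξ U) :
    lag (caTile f τ σ ξ) = (pairSet U).ncard - (stateSet U).ncard := by
  have h1 : ∀ (i : Fin τ) (j : Fin σ), caTile f τ σ ξ i j = U (i : ℕ) ((j : ℕ) : ZMod σ) := by
    intro i j
    unfold caTile
    rw [hU, Int.cast_natCast]
  have hrot : ∀ j : Fin σ, (((finRotate σ j : Fin σ) : ℕ) : ZMod σ) = ((j : ℕ) : ZMod σ) + 1 := by
    intro j
    obtain ⟨k, rfl⟩ : ∃ k, σ = k + 1 := ⟨σ - 1, by have := NeZero.pos σ; omega⟩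
    rw [finRotate_apply, Fin.val_add_one]
    split_ifs with h
    · subst h
      rw [Fin.val_last]
      have := ZMod.natCast_self (k + 1)
      push_cast at this ⊢
      exact this.symm
    · push_cast
      rfl
  have hex : ∀ (t : ZMod τ) (x : ZMod σ), ∃ (i : Fin τ) (j : Fin σ), ((i : ℕ) : ZMod τ) = t ∧
      ((j : ℕ) : ZMod σ) = x := fun t x =>
    ⟨⟨t.val, ZMod.val_lt t⟩, ⟨x.val, ZMod.val_lt x⟩, ZMod.natCast_zmod_val t,
      ZMod.natCast_zmod_val x⟩
  have h2 : {a : Fin n | ∃ i j, a = caTile f τ σ ξ i j} = stateSet U := by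
    ext a
    constructor
    · rintro ⟨i, j, rfl⟩
      exact ⟨((i : ℕ), (j : ℕ)), (h1 i j).symm⟩
    · rintro ⟨⟨t, x⟩, rfl⟩
      obtain ⟨i, j, rfl, rfl⟩ := hex t x
      exact ⟨i, j, (h1 i j).symm⟩
  have h3 : {q : Fin n × Fin n |
      ∃ i j, q = (caTile f τ σ ξ i j, caTile f τ σ ξ i (finRotate σ j))} = pairSet U := by
    ext a
    constructor
    · rintro ⟨i, j, rfl⟩
      refine ⟨((i : ℕ), (j : ℕ)), ?_⟩
      rw [h1, h1, hrot]
    · rintro ⟨⟨t, x⟩, rfl⟩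
      obtain ⟨i, j, rfl, rfl⟩ := hex t x
      refine ⟨i, j, ?_⟩
      rw [h1, h1, hrot]
  unfold lag assignmentNumber stateNumber
  rw [h2, h3]

/-- The rules with a collapsing array that is not simple. -/
def nonSimpleRules (τ σ n : ℕ) : Set (CARule n) :=
  {f | ∃ U : ZMod τ → ZMod σ → Fin n, (stateSet U).ncard < (pairSet U).ncard ∧
    Satisfies f U ∧ CollapsesAll f U}

/-- The rules with a collapsing simple array that has a state outside of column `0`. -/
def multiCycleRules (τ σ n : ℕ) : Set (CARule n) :=
  {f | ∃ U : ZMod τ → ZMod σ → Fin n, ((pairSet U).ncard ≤ (stateSet U).ncard ∧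
    ∀ m, U 0 1 ≠ U m 0) ∧ Satisfies f U ∧ CollapsesAll f U}

/-- The rules with a good cyclic word. -/
def goodRules (τ σ n : ℕ) : Set (CARule n) :=
  {f | ∃ p : (ZMod τ → Fin n) × ZMod τ, IsGood f σ p}

theorem wrps_subset [NeZero τ] [NeZero σ] :
    {f : CARule n | (wrpsSet f τ σ).Nonempty} ⊆
      goodRules τ σ n ∪ (nonSimpleRules τ σ n ∪ multiCycleRules τ σ n) := by
  rintro f ⟨ξ, hξ⟩
  obtain ⟨U, hU⟩ := hξ.isPS.exists_isSpaceTime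
  have hc : CollapsesAll f U := hξ.collapses hU
  rcases lt_or_ge (stateSet U).ncard (pairSet U).ncard with h | h
  · exact Or.inr (Or.inl ⟨U, h, hU.satisfies, hc⟩)
  · by_cases hm : ∃ m, U 0 1 = U m 0
    · obtain ⟨m, hm⟩ := hm
      exact Or.inl ⟨_, exists_isGood_of_simple hξ.isPS hU hc h hm⟩
    · push Not at hm
      exact Or.inr (Or.inr ⟨U, ⟨h, hm⟩, hU.satisfies, hc⟩)

theorem wrpsLag_subset [NeZero τ] [NeZero σ] {l : ℕ} (hl : 0 < l) :
    {f : CARule n | (wrpsSetLag f τ σ l).Nonempty} ⊆ nonSimpleRules τ σ n := by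
  rintro f ⟨ξ, hξ, hlag⟩
  obtain ⟨U, hU⟩ := hξ.isPS.exists_isSpaceTime
  rw [lag_caTile hU] at hlag
  exact ⟨U, by omega, hU.satisfies, hξ.collapses hU⟩

/-- Union bound over all arrays, when each array of a given kind costs at least an additional
factor `δ`. -/
theorem ruleProb_exists_array_le [NeZero τ] [NeZero σ] (δ : ℝ)
    (Q : (ZMod τ → ZMod σ → Fin n) → Prop) (hδ : 0 ≤ δ)
    (h : ∀ U, Q U → ruleProb n {f | Satisfies f U ∧ CollapsesAll f U} ≤
      δ * ((n : ℝ)⁻¹) ^ (stateSet U).ncard) :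
    ruleProb n {f | ∃ U : ZMod τ → ZMod σ → Fin n, Q U ∧ Satisfies f U ∧ CollapsesAll f U} ≤
      δ * ((τ * σ).factorial : ℝ) := by
  classical
  have h1 := ruleProb_exists_le (n := n) (fun W : ZMod τ × ZMod σ → Fin n =>
    {f | Q (Function.curry W) ∧ Satisfies f (Function.curry W) ∧ CollapsesAll f (Function.curry W)})
    {f | ∃ U : ZMod τ → ZMod σ → Fin n, Q U ∧ Satisfies f U ∧ CollapsesAll f U}
    (fun f ⟨U, hU⟩ => ⟨Function.uncurry U, hU⟩)
  refine h1.trans ?_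
  have h2 := sum_inv_pow_card_range_le (ZMod τ × ZMod σ) n
  rw [Fintype.card_prod, ZMod.card, ZMod.card] at h2
  refine le_trans ?_ (mul_le_mul_of_nonneg_left h2 hδ)
  rw [Finset.mul_sum]
  refine Finset.sum_le_sum fun W _ => ?_
  by_cases hQ : Q (Function.curry W)
  · refine (ruleProb_mono ?_).trans (h _ hQ)
    exact fun f hf => hf.2
  · have : {f | Q (Function.curry W) ∧ Satisfies f (Function.curry W) ∧
        CollapsesAll f (Function.curry W)} = ∅ := by
      ext f; simp [hQ]
    rw [this, ruleProb_empty]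
    positivity

theorem ncard_stateSet_le [NeZero τ] [NeZero σ] (U : ZMod τ → ZMod σ → Fin n) :
    (stateSet U).ncard ≤ τ * σ := by
  have h1 := Set.ncard_image_le (f := fun p : ZMod τ × ZMod σ => U p.1 p.2)
    (Set.finite_univ)
  rw [Set.image_univ, Set.ncard_univ, Nat.card_eq_fintype_card, Fintype.card_prod, ZMod.card,
    ZMod.card] at h1
  exact h1

theorem inv_pow_le_of_lt {k l : ℕ} (h : k < l) (hn : 0 < n) :
    ((n : ℝ)⁻¹) ^ l ≤ (n : ℝ)⁻¹ * ((n : ℝ)⁻¹) ^ k := by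
  rw [← pow_succ']
  refine pow_le_pow_of_le_one (by positivity) ?_ h
  exact inv_le_one_of_one_le₀ (by exact_mod_cast hn)
end

/-- The surplus pair gives the factor `1/n`, and the collapse of column `0` onto column `1` alone
gives the arbitrarily small constant. -/
theorem eventually_nonSimpleRules_le (τ σ : ℕ) [NeZero τ] [NeZero σ] (ε : ℝ) (hε : 0 < ε) :
    ∀ᶠ n : ℕ in atTop, ruleProb n (nonSimpleRules τ σ n) ≤ ε * (n : ℝ)⁻¹ := by
  have hC : (0 : ℝ) < ((τ * σ).factorial : ℝ) := by positivity
  obtain ⟨N, hN⟩ := exists_collapses_bound τ (τ * σ) (ε / ((τ * σ).factorial : ℝ)) (by positivity)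
  filter_upwards [eventually_ge_atTop N, eventually_gt_atTop 0] with n hnN hn
  refine (ruleProb_exists_array_le (ε / ((τ * σ).factorial : ℝ) * (n : ℝ)⁻¹) _ (by positivity)
    fun U hU => ?_).trans (le_of_eq ?_)
  · have h1 := hN n hnN (fun t => U t 0) (fun t => U t 1) (pairSet U) (stateSet U) (by
      rintro _ ⟨p, rfl⟩
      exact ⟨(p.1, p.2 + 1), rfl⟩) (ncard_stateSet_le U) (fun i => ⟨(i, 1), rfl⟩)
      {f | Satisfies f U ∧ CollapsesAll f U} (by
        rintro f ⟨hf, -⟩ g ⟨hg, -⟩ _ ⟨p, rfl⟩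
        exact (hf p.1 p.2).trans (hg p.1 p.2).symm) (by
        rintro f ⟨-, hf⟩
        have := hf 0
        rwa [zero_add] at this)
    refine h1.trans ?_
    rw [mul_assoc]
    gcongr
    exact inv_pow_le_of_lt hU hn
  · field_simp

theorem eventually_multiCycleRules_le (τ σ : ℕ) [NeZero τ] [NeZero σ] (ε : ℝ) (hε : 0 < ε) :
    ∀ᶠ n : ℕ in atTop, ruleProb n (multiCycleRules τ σ n) ≤ ε * (n : ℝ)⁻¹ := by
  set C : ℝ := ((τ * σ : ℕ) : ℝ) ^ 2 * ((τ * σ).factorial : ℝ) with hC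
  have hlim : Tendsto (fun n : ℕ => C / (n : ℝ)) atTop (𝓝 0) :=
    tendsto_const_div_atTop_nhds_zero_nat _
  filter_upwards [hlim.eventually_lt_const hε, eventually_gt_atTop 0] with n hnN hn
  refine (ruleProb_exists_array_le (((τ * σ : ℕ) : ℝ) ^ 2 * ((n : ℝ)⁻¹) ^ 2) _ (by positivity)
    fun U hU => ?_).trans ?_
  · refine (ruleProb_simple_le hn U hU.1 hU.2).trans ?_
    have h1 : ((stateSet U).ncard : ℝ) ≤ ((τ * σ : ℕ) : ℝ) := by
      exact_mod_cast ncard_stateSet_le U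
    rw [pow_add, mul_assoc (((τ * σ : ℕ) : ℝ) ^ 2), mul_comm (((n : ℝ)⁻¹) ^ 2)]
    gcongr
  · have h1 : ((τ * σ : ℕ) : ℝ) ^ 2 * ((n : ℝ)⁻¹) ^ 2 * ((τ * σ).factorial : ℝ) =
        C / n * (n : ℝ)⁻¹ := by rw [hC]; ring
    rw [h1]
    gcongr

/-! ### Pairs of good words -/

section
variable {n τ σ : ℕ}

/-- The two cyclic words agree up to a shift. -/
def ShiftEquiv (p q : (ZMod τ → Fin n) × ZMod τ) : Prop :=
  p.2 = q.2 ∧ ∃ s, ∀ i, q.1 i = p.1 (i + s)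

/-- The drivers of a pair of cyclic words. -/
def pairDrivers (p q : (ZMod τ → Fin n) × ZMod τ) : ZMod τ ⊕ ZMod τ → Fin n :=
  Sum.elim p.1 q.1

/-- The right neighbours of the drivers of a pair of cyclic words. -/
def pairTargets (p q : (ZMod τ → Fin n) × ZMod τ) : ZMod τ ⊕ ZMod τ → Fin n :=
  Sum.elim (fun i => p.1 (i + p.2)) (fun i => q.1 (i + q.2))

/-- With no surplus pair, a state determines its right neighbour across both words. From a common
state one then follows both words in step, which forces equality up to a shift; injectivity gives
equal steps `p.2` and `q.2`. -/
theorem shiftEquiv_of_meet [NeZero τ] {f : CARule n} {p q : (ZMod τ → Fin n) × ZMod τ}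
    (hp : IsGood f σ p) (hq : IsGood f σ q)
    (hs : (Set.range fun k => (pairDrivers p q k, pairTargets p q k)).ncard ≤
      (Set.range (pairDrivers p q)).ncard) {i j : ZMod τ} (hij : p.1 i = q.1 j) :
    ShiftEquiv p q := by
  have hright : ∀ {i j}, p.1 i = q.1 j → p.1 (i + p.2) = q.1 (j + q.2) := fun {i j} h =>
    eq_of_ncard_pairs_le hs (p := Sum.inl i) (q := Sum.inr j) h
  have hrights : ∀ (k : ℕ) {i j}, p.1 i = q.1 j → p.1 (i + k * p.2) = q.1 (j + k * q.2) := by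
    intro k i j h
    induction k with
    | zero => simpa using h
    | succ k ih =>
      have := hright ih
      push_cast
      rwa [add_mul, one_mul, ← add_assoc, add_mul, one_mul, ← add_assoc]
  have hone : ∀ {i j}, p.1 i = q.1 j → p.1 (i + 1) = q.1 (j + 1) := by
    intro i j h
    -- Going right a number of times congruent to `-1` modulo `τ` reaches the left neighbour, from
    -- which the pins give the next state.
    have h1 := hrights (-1 : ZMod τ).val h
    rw [ZMod.natCast_zmod_val] at h1
    have h2 := hright h1
    have h3 := hp.pin (i + -1 * p.2)
    have h4 := hq.pin (j + -1 * q.2)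
    rw [h1, h2, h4] at h3
    have h5 : i + -1 * p.2 + p.2 + 1 = i + 1 := by ring
    have h6 : j + -1 * q.2 + q.2 + 1 = j + 1 := by ring
    rw [h5, h6] at h3
    exact h3.symm
  have hadd : ∀ k : ℕ, p.1 (i + k) = q.1 (j + k) := by
    intro k
    induction k with
    | zero => simpa using hij
    | succ k ih =>
      have := hone ih
      push_cast
      rwa [← add_assoc, ← add_assoc]
  have hall : ∀ x : ZMod τ, q.1 x = p.1 (x + (i - j)) := by
    intro x
    have := hadd (x - j).val
    rw [ZMod.natCast_zmod_val] at this
    have h5 : i + (x - j) = x + (i - j) := by ring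
    rw [h5, add_sub_cancel] at this
    exact this.symm
  refine ⟨?_, i - j, hall⟩
  have h1 := hright hij
  rw [hall] at h1
  have h2 := hp.inj h1
  have h3 : j + q.2 + (i - j) = i + q.2 := by ring
  rw [h3] at h2
  exact add_left_cancel h2

theorem sum_map_iterate_inl {α β : Type*} (F : α → α) (G : β → β) (k : ℕ) (x : α) :
    (Sum.map F G)^[k] (Sum.inl x) = Sum.inl (F^[k] x) := by
  induction k generalizing x with
  | zero => rfl
  | succ k ih => rw [Function.iterate_succ_apply, Sum.map_inl, ih, Function.iterate_succ_apply]

theorem sum_map_iterate_inr {α β : Type*} (F : α → α) (G : β → β) (k : ℕ) (x : β) :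
    (Sum.map F G)^[k] (Sum.inr x) = Sum.inr (G^[k] x) := by
  induction k generalizing x with
  | zero => rfl
  | succ k ih => rw [Function.iterate_succ_apply, Sum.map_inr, ih, Function.iterate_succ_apply]

theorem collapses_sum {α β : Type*} {f : CARule n} {F : α → α} {G : β → β} {a c : α → Fin n}
    {a' c' : β → Fin n} (h : Collapses f F a c) (h' : Collapses f G a' c') :
    Collapses f (Sum.map F G) (Sum.elim a a') (Sum.elim c c') := by
  rintro ⟨i | i, y⟩
  · have key : ∀ k : ℕ, (drivenStep f (Sum.map F G) (Sum.elim a a'))^[k] (Sum.inl i, y) =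
        (Sum.inl ((drivenStep f F a)^[k] (i, y)).1, ((drivenStep f F a)^[k] (i, y)).2) := by
      intro k
      induction k with
      | zero => rfl
      | succ k ih =>
        rw [Function.iterate_succ_apply', ih, Function.iterate_succ_apply']
        rfl
    obtain ⟨k, hk⟩ := h (i, y)
    exact ⟨k, by rw [key]; exact hk⟩
  · have key : ∀ k : ℕ, (drivenStep f (Sum.map F G) (Sum.elim a a'))^[k] (Sum.inr i, y) =
        (Sum.inr ((drivenStep f G a')^[k] (i, y)).1, ((drivenStep f G a')^[k] (i, y)).2) := by
      intro k
      induction k with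
      | zero => rfl
      | succ k ih =>
        rw [Function.iterate_succ_apply', ih, Function.iterate_succ_apply']
        rfl
    obtain ⟨k, hk⟩ := h' (i, y)
    exact ⟨k, by rw [key]; exact hk⟩

theorem IsGood.pin_right {f : CARule n} {p : (ZMod τ → Fin n) × ZMod τ} (h : IsGood f σ p)
    (i : ZMod τ) : f (p.1 i) (p.1 (i + p.2)) = p.1 (i + 1 + p.2) := by
  rw [h.pin, add_right_comm]

theorem IsGood.shift {f : CARule n} {p : (ZMod τ → Fin n) × ZMod τ} (h : IsGood f σ p)
    (s : ZMod τ) : IsGood f σ (fun i => p.1 (i + s), p.2) := by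
  refine ⟨h.inj.comp (add_left_injective s), h.order, fun i => ?_, ?_⟩
  · have := h.pin (i + s)
    simp only
    rw [add_right_comm i p.2 s, this, add_right_comm _ 1 s, add_right_comm i p.2 s]
  · have := collapses_shift h.collapse s
    have h2 : (fun i => p.1 (i + p.2 + s)) = fun i => p.1 (i + s + p.2) := by
      funext i
      rw [add_right_comm]
    simp only
    rw [h2]
    exact this

theorem ruleProb_disjoint_pair_le [NeZero τ] (hn : 0 < n) (p q : (ZMod τ → Fin n) × ZMod τ)
    (hpq : Function.Injective (pairDrivers p q)) :
    ruleProb n {f | IsGood f σ p ∧ IsGood f σ q} ≤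
      ((2 * τ : ℕ) : ℝ) ^ 2 * ((n : ℝ)⁻¹) ^ 2 *
        ((n : ℝ)⁻¹) ^ (Set.range (pairDrivers p q)).ncard := by
  have h1 := ruleProb_pinned_collapses_le hn (Sum.map (· + 1) (· + 1)) (pairDrivers p q)
    (pairTargets p q) hpq (Sum.inl 0) (Sum.inr 0) (fun k l h => by
      rw [sum_map_iterate_inl, sum_map_iterate_inr] at h
      cases h)
  have h2 : (Set.range (pairDrivers p q)).ncard = 2 * τ := by
    rw [← Set.image_univ, Set.ncard_image_of_injective _ hpq, Set.ncard_univ,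
      Nat.card_eq_fintype_card, Fintype.card_sum, ZMod.card, two_mul]
  rw [h2]
  rw [Fintype.card_sum, ZMod.card, ← two_mul, add_comm (2 * τ) 2, pow_add, ← mul_assoc] at h1
  refine (ruleProb_mono ?_).trans h1
  rintro f ⟨hp, hq⟩
  refine ⟨?_, collapses_sum hp.collapse hq.collapse⟩
  rintro (i | i)
  · exact hp.pin_right i
  · exact hq.pin_right i
end

/-- If the words share a state there is a surplus pair, worth `1/n`, and one collapse supplies `ε`.
If they are disjoint, their drivers form two disjoint cycles and the joint collapse costs `n ^
(-2)`. -/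
theorem eventually_inequivalent_pair_le (τ σ : ℕ) [NeZero τ] (ε : ℝ) (hε : 0 < ε) :
    ∀ᶠ n : ℕ in atTop, ∀ p q : (ZMod τ → Fin n) × ZMod τ,
      ruleProb n {f | IsGood f σ p ∧ IsGood f σ q ∧ ¬ ShiftEquiv p q} ≤
        ε * (n : ℝ)⁻¹ * ((n : ℝ)⁻¹) ^ (Set.range (pairDrivers p q)).ncard := by
  obtain ⟨N, hN⟩ := exists_collapses_bound τ (2 * τ) ε hε
  have hlim : Tendsto (fun n : ℕ => ((2 * τ : ℕ) : ℝ) ^ 2 / (n : ℝ)) atTop (𝓝 0) :=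
    tendsto_const_div_atTop_nhds_zero_nat _
  filter_upwards [eventually_ge_atTop N, eventually_gt_atTop 0, hlim.eventually_lt_const hε]
    with n hnN hn hnε p q
  rcases Set.eq_empty_or_nonempty {f | IsGood f σ p ∧ IsGood f σ q ∧ ¬ ShiftEquiv p q} with
    hE | ⟨g, hgp, hgq, hg⟩
  · rw [hE, ruleProb_empty]
    positivity
  by_cases hmeet : ∃ i j, p.1 i = q.1 j
  · obtain ⟨i, j, hij⟩ := hmeet
    have hlt : (Set.range (pairDrivers p q)).ncard <
        (Set.range fun k => (pairDrivers p q k, pairTargets p q k)).ncard := by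
      by_contra! hle
      exact hg (shiftEquiv_of_meet hgp hgq hle hij)
    have hcard : (Set.range (pairDrivers p q)).ncard ≤ 2 * τ := by
      rw [← Set.image_univ]
      refine (Set.ncard_image_le Set.finite_univ).trans ?_
      rw [Set.ncard_univ, Nat.card_eq_fintype_card, Fintype.card_sum, ZMod.card, two_mul]
    have h1 := hN n hnN p.1 (fun i => p.1 (i + p.2))
      (Set.range fun k => (pairDrivers p q k, pairTargets p q k)) (Set.range (pairDrivers p q))
      (by
        rintro _ ⟨k | k, rfl⟩
        · exact ⟨Sum.inl (k + p.2), rfl⟩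
        · exact ⟨Sum.inr (k + q.2), rfl⟩) hcard (fun i => ⟨Sum.inl (i + p.2), rfl⟩)
      {f | IsGood f σ p ∧ IsGood f σ q ∧ ¬ ShiftEquiv p q} (by
        rintro f ⟨hfp, hfq, -⟩ f' ⟨hfp', hfq', -⟩ _ ⟨k | k, rfl⟩
        · exact (hfp.pin k).trans (hfp'.pin k).symm
        · exact (hfq.pin k).trans (hfq'.pin k).symm) (fun f hf => hf.1.collapse)
    refine h1.trans ?_
    rw [mul_assoc]
    gcongr
    exact inv_pow_le_of_lt hlt hn
  · push Not at hmeet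
    have hinj : Function.Injective (pairDrivers p q) :=
      Function.Injective.sumElim hgp.inj hgq.inj hmeet
    refine (ruleProb_mono ?_).trans ((ruleProb_disjoint_pair_le (σ := σ) hn p q hinj).trans ?_)
    · exact fun f hf => ⟨hf.1, hf.2.1⟩
    · refine mul_le_mul_of_nonneg_right ?_ (by positivity)
      have h1 : ((2 * τ : ℕ) : ℝ) ^ 2 * ((n : ℝ)⁻¹) ^ 2 =
          ((2 * τ : ℕ) : ℝ) ^ 2 / n * (n : ℝ)⁻¹ := by ring
      rw [h1]
      gcongr

theorem eventually_sum_inequivalent_le (τ σ : ℕ) [NeZero τ] (ε : ℝ) (hε : 0 < ε) :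
    ∀ᶠ n : ℕ in atTop, ∑ r : ((ZMod τ → Fin n) × ZMod τ) × ((ZMod τ → Fin n) × ZMod τ),
      ruleProb n {f | IsGood f σ r.1 ∧ IsGood f σ r.2 ∧ ¬ ShiftEquiv r.1 r.2} ≤
        ε * (n : ℝ)⁻¹ := by
  classical
  set C : ℝ := (τ : ℝ) ^ 2 * ((2 * τ).factorial : ℝ) with hC
  have hτ : (0 : ℝ) < τ := by exact_mod_cast NeZero.pos τ
  have hCpos : 0 < C := by positivity
  filter_upwards [eventually_inequivalent_pair_le τ σ (ε / C) (by positivity)] with n hn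
  refine (Finset.sum_le_sum fun r _ => hn r.1 r.2).trans ?_
  rw [← Finset.mul_sum]
  have h1 : ∑ r : ((ZMod τ → Fin n) × ZMod τ) × ((ZMod τ → Fin n) × ZMod τ),
      ((n : ℝ)⁻¹) ^ (Set.range (pairDrivers r.1 r.2)).ncard ≤ C := by
    -- Two words are one map on `ZMod τ ⊕ ZMod τ`; the two steps contribute only the constant `τ ^
    -- 2`.
    have h2 : ∑ r : ((ZMod τ → Fin n) × ZMod τ) × ((ZMod τ → Fin n) × ZMod τ),
        ((n : ℝ)⁻¹) ^ (Set.range (pairDrivers r.1 r.2)).ncard =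
        ∑ r : (ZMod τ × ZMod τ) × (ZMod τ ⊕ ZMod τ → Fin n),
          ((n : ℝ)⁻¹) ^ (Set.range r.2).ncard := by
      refine Fintype.sum_equiv ⟨fun r => ((r.1.2, r.2.2), Sum.elim r.1.1 r.2.1),
        fun r => ((fun i => r.2 (Sum.inl i), r.1.1), (fun i => r.2 (Sum.inr i), r.1.2)),
        fun r => rfl, fun r => ?_⟩ _ _ fun r => rfl
      refine Prod.ext rfl ?_
      funext i
      cases i <;> rfl
    rw [h2, Fintype.sum_prod_type]
    simp only [Finset.sum_const, Finset.card_univ, Fintype.card_prod, ZMod.card, nsmul_eq_mul]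
    have h3 := sum_inv_pow_card_range_le (ZMod τ ⊕ ZMod τ) n
    rw [Fintype.card_sum, ZMod.card, ← two_mul] at h3
    rw [hC, Nat.cast_mul, sq]
    gcongr
  calc ε / C * (n : ℝ)⁻¹ * _ ≤ ε / C * (n : ℝ)⁻¹ * C := by gcongr
    _ = ε * (n : ℝ)⁻¹ := by field_simp

/-! ### The expected number of good words -/

section
variable {n τ σ : ℕ} [NeZero τ]

/-- A good word brings its `τ` shifts, which are distinct because its states are. -/
theorem mul_ruleProb_goodRules_le (n τ σ : ℕ) [NeZero τ] :
    (τ : ℝ) * ruleProb n (goodRules τ σ n) ≤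
      ∑ p : (ZMod τ → Fin n) × ZMod τ, ruleProb n {f | IsGood f σ p} := by
  classical
  have hpt : ∀ f : CARule n, (1 : ℝ) * (∑ _s : ZMod τ, if f ∈ goodRules τ σ n then (1 : ℝ) else 0) ≤
      1 * ∑ p : (ZMod τ → Fin n) × ZMod τ, if f ∈ {f | IsGood f σ p} then (1 : ℝ) else 0 := by
    intro f
    by_cases hf : f ∈ goodRules τ σ n
    · obtain ⟨p, hp⟩ := hf
      rw [one_mul, one_mul, Finset.sum_boole, Finset.sum_boole]
      norm_cast
      refine Finset.card_le_card_of_injOn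
        (fun s => ((fun i => p.1 (i + s), p.2) : (ZMod τ → Fin n) × ZMod τ)) ?_ ?_
      · intro s _
        exact Finset.mem_coe.2 (Finset.mem_filter.2 ⟨Finset.mem_univ _, hp.shift s⟩)
      · intro s _ s' _ hss
        have h1 := congrFun (congrArg Prod.fst hss) 0
        simpa using hp.inj h1
    · simp only [if_neg hf, Finset.sum_const_zero, mul_zero, one_mul]
      exact Finset.sum_nonneg fun p _ => by positivity
  have h := ruleProb_sum_le_sum (fun _ : ZMod τ => goodRules τ σ n)
    (fun p : (ZMod τ → Fin n) × ZMod τ => {f | IsGood f σ p}) 1 1 fun f => by convert hpt f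
  simpa using h

/-- Fix one good word `p`. Every good word is one of at most `τ` shifts of `p`, or forms with `p` an
inequivalent pair. -/
theorem sum_isGood_le (n τ σ : ℕ) [NeZero τ] :
    ∑ p : (ZMod τ → Fin n) × ZMod τ, ruleProb n {f | IsGood f σ p} ≤
      τ * ruleProb n (goodRules τ σ n) +
      ∑ r : ((ZMod τ → Fin n) × ZMod τ) × ((ZMod τ → Fin n) × ZMod τ),
        ruleProb n {f | IsGood f σ r.1 ∧ IsGood f σ r.2 ∧ ¬ ShiftEquiv r.1 r.2} := by
  classical
  let B : ZMod τ ⊕ (((ZMod τ → Fin n) × ZMod τ) × ((ZMod τ → Fin n) × ZMod τ)) →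
      Set (CARule n) := Sum.elim (fun _ => goodRules τ σ n)
        fun r => {f | IsGood f σ r.1 ∧ IsGood f σ r.2 ∧ ¬ ShiftEquiv r.1 r.2}
  have hpt : ∀ f : CARule n,
      (1 : ℝ) * (∑ p : (ZMod τ → Fin n) × ZMod τ, if f ∈ {f | IsGood f σ p} then (1 : ℝ) else 0) ≤
      1 * ∑ k, if f ∈ B k then (1 : ℝ) else 0 := by
    intro f
    rw [one_mul, one_mul, Finset.sum_boole, Finset.sum_boole]
    norm_cast
    by_cases hf : f ∈ goodRules τ σ n
    · obtain ⟨p, hp⟩ := hf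
      refine Finset.card_le_card_of_injOn
        (fun q => if h : ShiftEquiv p q then Sum.inl h.2.choose else Sum.inr (p, q)) ?_ ?_
      · intro q hq
        have hq' : IsGood f σ q := (Finset.mem_filter.1 (Finset.mem_coe.1 hq)).2
        refine Finset.mem_coe.2 (Finset.mem_filter.2 ⟨Finset.mem_univ _, ?_⟩)
        by_cases h : ShiftEquiv p q
        · simp only [dif_pos h]
          exact ⟨p, hp⟩
        · simp only [dif_neg h]
          exact ⟨hp, hq', h⟩
      · intro q _ q' _ hqq
        simp only at hqq
        by_cases h : ShiftEquiv p q <;> by_cases h' : ShiftEquiv p q'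
        · rw [dif_pos h, dif_pos h'] at hqq
          have hs := Sum.inl.inj hqq
          refine Prod.ext ?_ (h.1.symm.trans h'.1)
          funext i
          rw [h.2.choose_spec, h'.2.choose_spec, hs]
        · rw [dif_pos h, dif_neg h'] at hqq
          cases hqq
        · rw [dif_neg h, dif_pos h'] at hqq
          cases hqq
        · rw [dif_neg h, dif_neg h'] at hqq
          exact congrArg Prod.snd (Sum.inr.inj hqq)
    · have : (Finset.univ.filter fun p : (ZMod τ → Fin n) × ZMod τ =>
          f ∈ {f | IsGood f σ p}) = ∅ :=
        Finset.filter_eq_empty_iff.2 fun p _ hp => hf ⟨p, hp⟩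
      rw [this]
      exact Nat.zero_le _
  have h := ruleProb_sum_le_sum (fun p : (ZMod τ → Fin n) × ZMod τ => {f | IsGood f σ p})
    B 1 1 fun f => by convert hpt f
  rw [one_mul, one_mul, Fintype.sum_sum_type] at h
  simpa [B] using h

/-- As `σ` divides `τ`, the cyclic group `ZMod τ` has `φ(σ)` elements of order `σ`; each goes with
any injective word, and all such choices have the same probability. -/
theorem sum_isGood_eq (hn : 0 < n) (hd : σ ∣ τ) :
    ∑ p : (ZMod τ → Fin n) × ZMod τ, ruleProb n {f | IsGood f σ p} =
      Nat.totient σ * (n.descFactorial τ * (((n : ℝ)⁻¹) ^ (2 * τ) *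
        ((n : ℝ) ^ τ - ((n : ℝ) - 1) ^ τ))) := by
  classical
  set v := ((n : ℝ)⁻¹) ^ (2 * τ) * ((n : ℝ) ^ τ - ((n : ℝ) - 1) ^ τ) with hv
  have h1 : ∀ p : (ZMod τ → Fin n) × ZMod τ, ruleProb n {f | IsGood f σ p} =
      (if addOrderOf p.2 = σ then 1 else 0) * ((if Function.Injective p.1 then 1 else 0) * v) := by
    intro p
    by_cases hm : addOrderOf p.2 = σ
    · by_cases ha : Function.Injective p.1
      · rw [if_pos hm, if_pos ha, one_mul, one_mul, hv,
          ← ruleProb_cycle_collapses hn p.1 (fun i => p.1 (i + p.2)) ha]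
        congr 1
        ext f
        constructor
        · exact fun h => ⟨h.pin_right, h.collapse⟩
        · rintro ⟨h2, h3⟩
          exact ⟨ha, hm, fun i => by rw [h2, add_right_comm], h3⟩
      · have : {f | IsGood f σ p} = ∅ := by
          ext f
          exact ⟨fun h => ha h.inj, fun h => h.elim⟩
        rw [this, ruleProb_empty, if_neg ha]
        ring
    · have : {f | IsGood f σ p} = ∅ := by
        ext f
        exact ⟨fun h => hm h.order, fun h => h.elim⟩
      rw [this, ruleProb_empty, if_neg hm]
      ring
  simp_rw [h1]
  rw [Fintype.sum_prod_type, Finset.sum_comm]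
  change ∑ m : ZMod τ, ∑ a : ZMod τ → Fin n, (if addOrderOf m = σ then (1 : ℝ) else 0) *
    ((if Function.Injective a then 1 else 0) * v) = _
  rw [← Finset.sum_mul_sum, ← Finset.sum_mul, Finset.sum_boole, Finset.sum_boole]
  congr 2
  · rw [IsAddCyclic.card_addOrderOf_eq_totient (by simpa using hd)]
  · congr 1
    have h2 : (Finset.univ.filter fun a : ZMod τ → Fin n => Function.Injective a).card =
        Fintype.card (ZMod τ ↪ Fin n) := by
      rw [← Fintype.card_subtype]
      exact Fintype.card_congr (Equiv.subtypeInjectiveEquivEmbedding _ _)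
    rw [h2, Fintype.card_embedding_eq, Fintype.card_fin, ZMod.card]
end

/-! ### Asymptotics and conclusion -/

theorem tendsto_descFactorial_div_pow (τ : ℕ) :
    Tendsto (fun n : ℕ => (n.descFactorial τ : ℝ) * ((n : ℝ)⁻¹) ^ τ) atTop (𝓝 1) := by
  induction τ with
  | zero => simp
  | succ k ih =>
    have h1 : Tendsto (fun n : ℕ => 1 - (k : ℝ) / (n : ℝ)) atTop (𝓝 (1 - 0)) :=
      (tendsto_const_div_atTop_nhds_zero_nat _).const_sub 1
    have h2 := h1.mul ih
    rw [sub_zero, one_mul] at h2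
    refine h2.congr' ?_
    filter_upwards [eventually_gt_atTop k] with n hn
    have hn' : (n : ℝ) ≠ 0 := by
      have : 0 < n := by omega
      positivity
    rw [Nat.descFactorial_succ, Nat.cast_mul, Nat.cast_sub hn.le, pow_succ]
    field_simp

/-- By the geometric sum, `n (1 - (1 - 1/n) ^ τ)` equals the sum of `(1 - 1/n) ^ i` over `i < τ`,
and each term tends to `1`. -/
theorem tendsto_mul_one_sub_pow (τ : ℕ) :
    Tendsto (fun n : ℕ => (n : ℝ) * (((n : ℝ)⁻¹) ^ τ * ((n : ℝ) ^ τ - ((n : ℝ) - 1) ^ τ)))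
      atTop (𝓝 τ) := by
  have h1 : Tendsto (fun n : ℕ => 1 - (1 : ℝ) / (n : ℝ)) atTop (𝓝 (1 - 0)) :=
    (tendsto_const_div_atTop_nhds_zero_nat _).const_sub 1
  rw [sub_zero] at h1
  have h2 : Tendsto (fun n : ℕ => ∑ i ∈ Finset.range τ, (1 - (1 : ℝ) / (n : ℝ)) ^ i) atTop
      (𝓝 (∑ i ∈ Finset.range τ, (1 : ℝ) ^ i)) :=
    tendsto_finsetSum _ fun i _ => h1.pow i
  simp only [one_pow, Finset.sum_const, Finset.card_range, nsmul_eq_mul, mul_one] at h2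
  refine h2.congr' ?_
  filter_upwards [eventually_gt_atTop 0] with n hn
  have hn' : (n : ℝ) ≠ 0 := by positivity
  have h3 := mul_neg_geom_sum (1 - (1 : ℝ) / (n : ℝ)) τ
  have h4 : ((n : ℝ)⁻¹) ^ τ * ((n : ℝ) ^ τ - ((n : ℝ) - 1) ^ τ) = 1 - (1 - (1 : ℝ) / n) ^ τ := by
    rw [mul_sub, ← mul_pow, ← mul_pow, inv_mul_cancel₀ hn', one_pow, mul_sub,
      inv_mul_cancel₀ hn', mul_one, one_div]
  rw [h4, ← h3, sub_sub_cancel, ← mul_assoc, mul_one_div, div_self hn', one_mul]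

theorem tendsto_mul_sum_isGood {τ σ : ℕ} [NeZero τ] (hd : σ ∣ τ) :
    Tendsto (fun n : ℕ => (n : ℝ) *
      ∑ p : (ZMod τ → Fin n) × ZMod τ, ruleProb n {f | IsGood f σ p}) atTop
      (𝓝 (Nat.totient σ * τ)) := by
  have h1 := ((tendsto_descFactorial_div_pow τ).mul (tendsto_mul_one_sub_pow τ)).const_mul
    (Nat.totient σ : ℝ)
  rw [one_mul] at h1
  refine h1.congr' ?_
  filter_upwards [eventually_gt_atTop 0] with n hn
  rw [sum_isGood_eq hn hd, two_mul, pow_add]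
  ring

theorem mainTheorem4 (τ σ : ℕ) (hτ : 0 < τ) (hσ : 0 < σ) :
    (σ ∣ τ →
      (fun n : ℕ => ruleProb n {f : CARule n | (wrpsSet f τ σ).Nonempty}
          - (Nat.totient σ : ℝ) / (n : ℝ))
        =o[atTop] (fun n : ℕ => 1 / (n : ℝ))) ∧
    (∀ ℓ : ℕ, 0 < ℓ →
      (fun n : ℕ => ruleProb n {f : CARule n | (wrpsSetLag f τ σ ℓ).Nonempty})
        =o[atTop] (fun n : ℕ => 1 / (n : ℝ))) := by
  have : NeZero τ := ⟨hτ.ne'⟩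
  have : NeZero σ := ⟨hσ.ne'⟩
  constructor
  · intro hd
    refine isLittleO_iff.2 fun ε hε => ?_
    -- Four errors of size `ε / 4` suffice: the limit of the first moment, the two kinds of
    -- negligible arrays, and the inequivalent pairs. The final comparisons are multiplied by `τ ≥
    -- 1`, since the first moment counts every shift.
    have hlim := Metric.tendsto_nhds.1 (tendsto_mul_sum_isGood hd) (ε / 4) (by positivity)
    filter_upwards [hlim, eventually_nonSimpleRules_le τ σ (ε / 4) (by positivity),
      eventually_multiCycleRules_le τ σ (ε / 4) (by positivity),
      eventually_sum_inequivalent_le τ σ (ε / 4) (by positivity), eventually_gt_atTop 0]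
      with n h1 h2 h3 h4 hn
    have hn' : (0 : ℝ) < n := by exact_mod_cast hn
    have hτ1 : (1 : ℝ) ≤ τ := by exact_mod_cast hτ
    have h5 := mul_ruleProb_goodRules_le n τ σ
    have h6 := sum_isGood_le n τ σ
    set EN := ∑ p : (ZMod τ → Fin n) × ZMod τ, ruleProb n {f | IsGood f σ p}
    set R := ruleProb n {f : CARule n | (wrpsSet f τ σ).Nonempty}
    set G := ruleProb n (goodRules τ σ n)
    have h7 : G ≤ R := ruleProb_mono fun f ⟨p, hp⟩ => hp.wrpsSet_nonempty
    have h8 : R ≤ G + (ε / 4 * (n : ℝ)⁻¹ + ε / 4 * (n : ℝ)⁻¹) :=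
      (ruleProb_mono wrps_subset).trans ((ruleProb_union_le _ _).trans
        (add_le_add le_rfl ((ruleProb_union_le _ _).trans (add_le_add h2 h3))))
    rw [Real.dist_eq, abs_lt] at h1
    have h9 : EN = (n : ℝ) * EN * (n : ℝ)⁻¹ := by field_simp
    have hx : (0 : ℝ) < (n : ℝ)⁻¹ := by positivity
    have h10 : EN ≤ (Nat.totient σ * τ + ε / 4) * (n : ℝ)⁻¹ := by
      rw [h9]
      exact mul_le_mul_of_nonneg_right (by linarith) hx.le
    have h11 : (Nat.totient σ * τ - ε / 4) * (n : ℝ)⁻¹ ≤ EN := by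
      rw [h9]
      exact mul_le_mul_of_nonneg_right (by linarith) hx.le
    have hεn : 0 < ε * (n : ℝ)⁻¹ := by positivity
    have hετ : ε * (n : ℝ)⁻¹ ≤ τ * (ε * (n : ℝ)⁻¹) := le_mul_of_one_le_left hεn.le hτ1
    have hτ0 : (0 : ℝ) < τ := by linarith
    rw [Real.norm_eq_abs, Real.norm_eq_abs, abs_of_pos (by positivity : (0 : ℝ) < 1 / n), one_div,
      abs_le, div_eq_mul_inv]
    constructor
    · refine le_of_mul_le_mul_left ?_ hτ0
      have := mul_le_mul_of_nonneg_left h7 hτ0.le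
      linarith
    · refine le_of_mul_le_mul_left ?_ hτ0
      have := mul_le_mul_of_nonneg_left h8 hτ0.le
      linarith
  · intro l hl
    refine isLittleO_iff.2 fun ε hε => ?_
    filter_upwards [eventually_nonSimpleRules_le τ σ ε hε, eventually_gt_atTop 0] with n h1 hn
    rw [Real.norm_eq_abs, Real.norm_eq_abs, abs_of_nonneg (ruleProb_nonneg _ _),
      abs_of_nonneg (by positivity), one_div]
    exact (ruleProb_mono (wrpsLag_subset hl)).trans h1
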